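/- Let $s,l$ be integers with $s<l<2s$. Let $X=X_{s,l}$ be the real vector space with basis $e_{s-l},\dots,e_s,f_{-s},\dots,f_{l-s}$, graded by giving $e_i$ and $f_i$ degree $i$, with the symplectic form $\sigma$ determined by $\sigma(e_i,e_j)=\sigma(f_i,f_j)=0$, $\sigma(e_i,f_{-i})=(-1)^{s-i}$ and $\sigma(e_i,f_j)=0$ for $j\ne -i$. Let $\delta=\delta_{s,l}$ be the degree $-1$ endomorphism $e_i\mapsto e_{i-1}$, $f_i\mapsto f_{i-1}$ (with $e_{s-l}\mapsto 0$, $f_{-s}\mapsto 0$), put $\delta_{\rm mod}=\mathbb R\delta$, and let $F_{s,l}=\operatorname{span}\{f_{-s},\dots,f_{l-s}\}$. Let $\mathfrak u^F(\delta_{\rm mod})=\bigoplus_{k\ge -1}\mathfrak u^F_k$ be the universal algebraic prolongation of $\delta_{\rm mod}$ in the conformal symplectic algebra $\mathfrak{csp}(X)$: $\mathfrak u^F_{-1}=\mathbb R\delta$, and for $k\ge 0$, $\mathfrak u^F_k$ consists of the $A\in\mathfrak{csp}(X)$ of degree $k$ with $[A,\delta]\in\mathfrak u^F_{k-1}$.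 Let $\eta=\eta^{-1}\oplus\eta^{-2}$, $\eta^{-1}=X$, $\eta^{-2}=\mathbb R$, be the Heisenberg algebra, with $[v,w]=\sigma(v,w)$ for $v,w\in X$ and $\eta^{-2}$ central. Let $\mathfrak u^k=\mathfrak u^k(\eta,\mathfrak u^F(\delta_{\rm mod}))$ be the Tanaka prolongations: $\mathfrak u^{-1}=\eta^{-1}$, $\mathfrak u^{-2}=\eta^{-2}$, $\mathfrak u^0=\mathfrak u^F(\delta_{\rm mod})$ (acting on $\eta$ by derivations), and for $k\ge1$, $\mathfrak u^k$ is the space of $\varphi\in\operatorname{Hom}(\eta^{-1},\mathfrak u^{k-1})\oplus\operatorname{Hom}(\eta^{-2},\mathfrak u^{k-2})$ with $\varphi([a,b])=[\varphi(a),b]+[a,\varphi(b)]$ for all $a,b\in\eta$, where $[\psi,a]=-[a,\psi]=\psi(a)$ for $\psi$ of degree $\ge 0$. Let $\mathfrak C\subset\mathbb P F_{s,l}$ be the rational normal curve, the closure of the orbit $t\mapsto[e^{t\delta}f_{l-s}]$; let $\mathcal T^{j}\mathfrak C$ be its $j$-th tangential developable, the Zariski closure of the union of the $j$-th osculating subspaces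 $\mathbb P\operatorname{span}\{\gamma(t),\gamma'(t),\dots,\gamma^{(j)}(t)\}$, $\gamma(t)=e^{t\delta}f_{l-s}$, $t\in\mathbb R$; let $S^k\mathcal E$ be the $k$-th secant variety, the Zariski closure of the union of the projective subspaces spanned by $k+1$ points of $\mathcal E$; and let $\mathcal I_d(\mathcal E)$ be the space of homogeneous polynomials of degree $d$ vanishing on $\mathcal E$. Then for every integer $k\ge1$ there is a linear isomorphism $$\Phi:\ \mathfrak u^k\bigl(\eta,\mathfrak u^F(\delta_{\rm mod})\bigr)\ \xrightarrow{\ \sim\ }\ \mathcal I_{k+2}\bigl(S^k(\mathcal T^{\,l-s-1}\mathfrak C)\bigr)$$ onto the space of polynomials of degree $k+2$ on $F_{s,l}$ vanishing on $S^k(\mathcal T^{\,l-s-1}\mathfrak C)$, and it is the natural one: $$\Phi(\varphi)(\pi_F v)=\sigma\bigl(v,\,[\dots[[\varphi,v],v],\dots,v]\bigr)\qquad(k+1\text{ brackets})$$ for all $\varphi\in\mathfrak u^k$ and $v\in X$, where $\pi_F:X\to F_{s,l}$ is the projection along $\operatorname{span}\{e_{s-l},\dots,e_s\}$. -/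

import Mathlib

namespace FlagProlongation

noncomputable section

/-! ### Tanaka prolongation of a Heisenberg algebra

`X` is a real vector space with a bilinear form `σ` (symplectic in the application).  The Heisenberg
algebra is `η = η⁻¹ ⊕ η⁻²` with `η⁻¹ = X`, `η⁻² = ℝ` (generator `1`, central) and
`[v, w] = σ v w`. -/

section Tanaka

variable (X : Type) [AddCommGroup X] [Module ℝ X]

/-- The ambient spaces of the prolongation procedure, shifted by two: `Amb X n` contains the
component of degree `n - 2`.  Degrees `-2`, `-1` are `η⁻² = ℝ`, `η⁻¹ = X`; in degree `d ≥ 0` it is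
`Hom(η⁻¹, degree d - 1) ⊕ Hom(η⁻², degree d - 2)`. -/
def Amb : ℕ → ModuleCat.{0} ℝ
  | 0 => ModuleCat.of ℝ ℝ
  | 1 => ModuleCat.of ℝ X
  | n + 2 => ModuleCat.of ℝ ((X →ₗ[ℝ] Amb (n + 1)) × (ℝ →ₗ[ℝ] Amb n))

variable {X}

/-- The restriction to `η⁻¹ = X` of an element of nonnegative degree. -/
def Amb.onX (n : ℕ) : Amb X (n + 2) →ₗ[ℝ] (X →ₗ[ℝ] Amb X (n + 1)) :=
  LinearMap.fst ℝ (X →ₗ[ℝ] Amb X (n + 1)) (ℝ →ₗ[ℝ] Amb X n)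

/-- The restriction to `η⁻² = ℝ` of an element of nonnegative degree. -/
def Amb.onZ (n : ℕ) : Amb X (n + 2) →ₗ[ℝ] (ℝ →ₗ[ℝ] Amb X n) :=
  LinearMap.snd ℝ (X →ₗ[ℝ] Amb X (n + 1)) (ℝ →ₗ[ℝ] Amb X n)

/-- The bracket `[f, w]` of an element `f` of degree `≥ -1` with `w ∈ η⁻¹ = X`: it is the bracket of
`η` if `f` has degree `-1`, and `[f, w] = f(w)` if `f` has degree `≥ 0`. -/
def Amb.bracket (σ : LinearMap.BilinForm ℝ X) :
    (n : ℕ) → Amb X (n + 1) →ₗ[ℝ] (X →ₗ[ℝ] Amb X n)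
  | 0 => σ
  | n + 1 => Amb.onX n

/-- The derivation identity `f([v, w]) = [f(v), w] + [v, f(w)]` for `v, w ∈ η⁻¹ = X`. -/
def IsDerXX (σ : LinearMap.BilinForm ℝ X) (n : ℕ) (f : Amb X (n + 2)) : Prop :=
  ∀ v w : X, Amb.onZ n f (σ v w) =
    Amb.bracket σ n (Amb.onX n f v) w - Amb.bracket σ n (Amb.onX n f w) v

/-- The derivation identity `0 = f([v, z]) = [f(v), z] + [v, f(z)]` for `v ∈ η⁻¹`, `z ∈ η⁻²` and `f`
of degree `≥ 1` (in degree `0` both sides lie in degree `-3` and the identity is void). -/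
def IsDerXZ (σ : LinearMap.BilinForm ℝ X) (n : ℕ) (f : Amb X (n + 3)) : Prop :=
  ∀ (v : X) (z : ℝ), Amb.onZ n (Amb.onX (n + 1) f v) z - Amb.bracket σ n (Amb.onZ (n + 1) f z) v = 0

theorem IsDerXX.add {σ : LinearMap.BilinForm ℝ X} {n : ℕ} {f g : Amb X (n + 2)}
    (hf : IsDerXX σ n f) (hg : IsDerXX σ n g) : IsDerXX σ n (f + g) := by
  intro v w
  have h1 := hf v w
  have h2 := hg v w
  simp only [map_add, LinearMap.add_apply] at h1 h2 ⊢
  rw [h1, h2]; abel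

theorem IsDerXX.smul {σ : LinearMap.BilinForm ℝ X} {n : ℕ} {f : Amb X (n + 2)} (c : ℝ)
    (hf : IsDerXX σ n f) : IsDerXX σ n (c • f) := by
  intro v w
  have h1 := hf v w
  simp only [map_smul, LinearMap.smul_apply] at h1 ⊢
  rw [h1, smul_sub]

theorem IsDerXX.zero (σ : LinearMap.BilinForm ℝ X) (n : ℕ) : IsDerXX σ n (0 : Amb X (n + 2)) := by
  intro v w
  simp

theorem IsDerXZ.add {σ : LinearMap.BilinForm ℝ X} {n : ℕ} {f g : Amb X (n + 3)}
    (hf : IsDerXZ σ n f) (hg : IsDerXZ σ n g) : IsDerXZ σ n (f + g) := by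
  intro v z
  have h1 := hf v z
  have h2 := hg v z
  rw [sub_eq_zero] at h1 h2
  simp only [map_add, LinearMap.add_apply] at h1 h2 ⊢
  rw [h1, h2, sub_self]

theorem IsDerXZ.smul {σ : LinearMap.BilinForm ℝ X} {n : ℕ} {f : Amb X (n + 3)} (c : ℝ)
    (hf : IsDerXZ σ n f) : IsDerXZ σ n (c • f) := by
  intro v z
  have h1 := hf v z
  rw [sub_eq_zero] at h1
  simp only [map_smul, LinearMap.smul_apply] at h1 ⊢
  rw [h1, sub_self]

theorem IsDerXZ.zero (σ : LinearMap.BilinForm ℝ X) (n : ℕ) : IsDerXZ σ n (0 : Amb X (n + 3)) := by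
  intro v z
  simp

/-- The components of the universal algebraic prolongation of the pair `(η, 𝔤⁰)`, shifted by two:
`tanakaAux σ g0 n` is the component of degree `n - 2`.  A subspace `g0` of `End X` is regarded as a
space of derivations of `η` preserving the grading. -/
def tanakaAux (σ : LinearMap.BilinForm ℝ X) (g0 : Submodule ℝ (Module.End ℝ X)) :
    (n : ℕ) → Submodule ℝ (Amb X n)
  | 0 => ⊤
  | 1 => ⊤
  | 2 =>
    { carrier := {f | Amb.onX 0 f ∈ g0 ∧ IsDerXX σ 0 f}
      add_mem' := fun hf hg => ⟨g0.add_mem hf.1 hg.1, hf.2.add hg.2⟩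
      zero_mem' := ⟨g0.zero_mem, IsDerXX.zero σ 0⟩
      smul_mem' := fun c _ hf => ⟨g0.smul_mem c hf.1, hf.2.smul c⟩ }
  | n + 3 =>
    { carrier := {f | (∀ v, Amb.onX (n + 1) f v ∈ tanakaAux σ g0 (n + 2)) ∧
        (∀ z, Amb.onZ (n + 1) f z ∈ tanakaAux σ g0 (n + 1)) ∧
        IsDerXX σ (n + 1) f ∧ IsDerXZ σ n f}
      add_mem' := fun hf hg =>
        ⟨fun v => by
          rw [map_add, LinearMap.add_apply]
          exact Submodule.add_mem _ (hf.1 v) (hg.1 v),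
        fun z => by
          rw [map_add, LinearMap.add_apply]
          exact Submodule.add_mem _ (hf.2.1 z) (hg.2.1 z),
        hf.2.2.1.add hg.2.2.1, hf.2.2.2.add hg.2.2.2⟩
      zero_mem' :=
        ⟨fun v => by
          rw [map_zero, LinearMap.zero_apply]
          exact Submodule.zero_mem _,
        fun z => by
          rw [map_zero, LinearMap.zero_apply]
          exact Submodule.zero_mem _,
        IsDerXX.zero σ (n + 1), IsDerXZ.zero σ n⟩
      smul_mem' := fun c _ hf =>
        ⟨fun v => by
          rw [map_smul, LinearMap.smul_apply]
          exact Submodule.smul_mem _ c (hf.1 v),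
        fun z => by
          rw [map_smul, LinearMap.smul_apply]
          exact Submodule.smul_mem _ c (hf.2.1 z),
        hf.2.2.1.smul c, hf.2.2.2.smul c⟩ }

/-- The `k`-th Tanaka algebraic prolongation `𝔲ᵏ(η, 𝔤⁰)` of the pair `(η, 𝔤⁰)`, `k ≥ 0`. -/
def tanakaProlongation (σ : LinearMap.BilinForm ℝ X) (g0 : Submodule ℝ (Module.End ℝ X)) (k : ℕ) :
    Submodule ℝ (Amb X (k + 2)) :=
  tanakaAux σ g0 (k + 2)

/-- `[…[[φ, v], v], …, v] ∈ X` with `n` brackets, for `φ` of degree `n - 1`. -/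
def iterBracket : (n : ℕ) → Amb X (n + 1) → X → X
  | 0, φ, _ => φ
  | n + 1, φ, v => iterBracket n (Amb.onX n φ v) v

end Tanaka

/-! ### Flag symbols and their universal algebraic prolongation -/

section Symbol

variable {X : Type} [AddCommGroup X] [Module ℝ X]

/-- The conformal symplectic algebra of a bilinear form `σ`. -/
def csp (σ : LinearMap.BilinForm ℝ X) : Submodule ℝ (Module.End ℝ X) where
  carrier := {A | ∃ c : ℝ, ∀ v w, σ (A v) w + σ v (A w) = c * σ v w}
  add_mem' := by
    rintro A B ⟨a, ha⟩ ⟨b, hb⟩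
    refine ⟨a + b, fun v w => ?_⟩
    have h1 := ha v w
    have h2 := hb v w
    simp only [LinearMap.add_apply, map_add]
    linarith
  zero_mem' := ⟨0, fun v w => by simp⟩
  smul_mem' := by
    rintro t A ⟨a, ha⟩
    refine ⟨t * a, fun v w => ?_⟩
    have h1 := ha v w
    simp only [LinearMap.smul_apply, map_smul, smul_eq_mul]
    rw [mul_assoc, ← h1]; ring

/-- The endomorphisms of degree `k` with respect to a grading `gr` indexed by `ℤ`. -/
def endDegree (gr : ℤ → Submodule ℝ X) (k : ℤ) : Submodule ℝ (Module.End ℝ X) where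
  carrier := {A | ∀ i, ∀ x ∈ gr i, A x ∈ gr (i + k)}
  add_mem' := fun hA hB i x hx => Submodule.add_mem _ (hA i x hx) (hB i x hx)
  zero_mem' := fun _ _ _ => Submodule.zero_mem _
  smul_mem' := fun c _ hA i x hx => Submodule.smul_mem _ c (hA i x hx)

/-- `uFComponent σ gr δ n` is the component of degree `n - 1` of the universal algebraic
prolongation of the line `ℝ δ` in `csp σ`: the line `ℝ δ` itself in degree `-1`, and
`{A ∈ cspᵏ | [A, δ] ∈ 𝔲ₖ₋₁}` in degree `k ≥ 0`. -/
def uFComponent (σ : LinearMap.BilinForm ℝ X) (gr : ℤ → Submodule ℝ X) (δ : Module.End ℝ X) :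
    ℕ → Submodule ℝ (Module.End ℝ X)
  | 0 => Submodule.span ℝ {δ}
  | n + 1 =>
    csp σ ⊓ endDegree gr (n : ℤ) ⊓
      { carrier := {A | A * δ - δ * A ∈ uFComponent σ gr δ n}
        add_mem' := fun {A B} hA hB => by
          have h := Submodule.add_mem _ hA hB
          have e : (A * δ - δ * A) + (B * δ - δ * B) = (A + B) * δ - δ * (A + B) := by noncomm_ring
          rw [e] at h
          exact h
        zero_mem' := by
          have h := Submodule.zero_mem (uFComponent σ gr δ n)
          have e : (0 : Module.End ℝ X) = 0 * δ - δ * 0 := by simp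
          rw [e] at h
          exact h
        smul_mem' := fun c A hA => by
          have h := Submodule.smul_mem _ c hA
          have e : c • (A * δ - δ * A) = (c • A) * δ - δ * (c • A) := by
            rw [smul_sub, smul_mul_assoc, mul_smul_comm]
          rw [e] at h
          exact h }

/-- The universal algebraic prolongation `𝔲ᶠ(ℝ δ) ⊆ csp σ` of the flag symbol `ℝ δ`. -/
def uF (σ : LinearMap.BilinForm ℝ X) (gr : ℤ → Submodule ℝ X) (δ : Module.End ℝ X) :
    Submodule ℝ (Module.End ℝ X) :=
  ⨆ n : ℕ, uFComponent σ gr δ n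

end Symbol

/-! ### The indecomposable symbols `δ_{s,l}` -/

/-- A row of a tableau: the space with basis indexed by the integers `i` with `a ≤ i ≤ b`, the
`i`-th basis vector having degree `i`. -/
abbrev Row (a b : ℤ) : Type := ↥(Finset.Icc a b) → ℝ

namespace Row

variable (a b : ℤ)

/-- The `i`-th coordinate, which is zero if `i` is not in `[a, b]`. -/
def coeff (i : ℤ) : Row a b →ₗ[ℝ] ℝ :=
  if h : i ∈ Finset.Icc a b then LinearMap.proj ⟨i, h⟩ else 0

/-- The `i`-th basis vector. -/
def vec (i : ℤ) : Row a b := fun j => if (j : ℤ) = i then 1 else 0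

/-- The shift sending the `i`-th basis vector to the `(i - 1)`-st one, and the `a`-th one to `0`. -/
def shift : Module.End ℝ (Row a b) :=
  LinearMap.pi fun i => coeff a b ((i : ℤ) + 1)

/-- The component of degree `i`. -/
def gr (i : ℤ) : Submodule ℝ (Row a b) where
  carrier := {x | ∀ j : ↥(Finset.Icc a b), (j : ℤ) ≠ i → x j = 0}
  add_mem' := fun hx hy j hj => by simp [hx j hj, hy j hj]
  zero_mem' := fun _ _ => rfl
  smul_mem' := fun c x hx j hj => by simp [hx j hj]

end Row

/-- `E_{s,l}`, with basis `e_{s-l}, …, e_s`. -/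
abbrev E (s l : ℤ) : Type := Row (s - l) s

/-- `F_{s,l}`, with basis `f_{-s}, …, f_{l-s}`. -/
abbrev F (s l : ℤ) : Type := Row (-s) (l - s)

/-- `X_{s,l} = E_{s,l} ⊕ F_{s,l}`. -/
abbrev XX (s l : ℤ) : Type := E s l × F s l

/-- The grading of `X_{s,l}`: the vectors `e_i` and `f_i` have degree `i`. -/
def gradingX (s l : ℤ) (i : ℤ) : Submodule ℝ (XX s l) :=
  (Row.gr (s - l) s i).prod (Row.gr (-s) (l - s) i)

/-- The symplectic form of `X_{s,l}`: `σ(e_i, f_{-i}) = (-1)^{s-i}`, `σ(e_i, f_j) = 0` for `j ≠ -i`,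
and `E_{s,l}`, `F_{s,l}` are isotropic. -/
def sigmaX (s l : ℤ) : LinearMap.BilinForm ℝ (XX s l) :=
  LinearMap.mk₂ ℝ
    (fun x y => ∑ i : ↥(Finset.Icc (s - l) s), (-1 : ℝ) ^ (s - (i : ℤ)) *
      (x.1 i * Row.coeff (-s) (l - s) (-(i : ℤ)) y.2
        - y.1 i * Row.coeff (-s) (l - s) (-(i : ℤ)) x.2))
    (fun x x' y => by
      rw [← Finset.sum_add_distrib]
      refine Finset.sum_congr rfl fun i _ => ?_
      simp only [Prod.fst_add, Prod.snd_add, Pi.add_apply, map_add]; ring)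
    (fun c x y => by
      rw [smul_eq_mul, Finset.mul_sum]
      refine Finset.sum_congr rfl fun i _ => ?_
      simp only [Prod.smul_fst, Prod.smul_snd, Pi.smul_apply, map_smul, smul_eq_mul]; ring)
    (fun x y y' => by
      rw [← Finset.sum_add_distrib]
      refine Finset.sum_congr rfl fun i _ => ?_
      simp only [Prod.fst_add, Prod.snd_add, Pi.add_apply, map_add]; ring)
    (fun c x y => by
      rw [smul_eq_mul, Finset.mul_sum]
      refine Finset.sum_congr rfl fun i _ => ?_
      simp only [Prod.smul_fst, Prod.smul_snd, Pi.smul_apply, map_smul, smul_eq_mul]; ring)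

/-- The degree `-1` endomorphism `δ_{s,l}` of `X_{s,l}`: `e_i ↦ e_{i-1}`, `f_i ↦ f_{i-1}`. -/
def deltaX (s l : ℤ) : Module.End ℝ (XX s l) :=
  LinearMap.prodMap (Row.shift (s - l) s) (Row.shift (-s) (l - s))

/-! ### Projective varieties -/

section Projective

open scoped LinearAlgebra.Projectivization

variable {ι : Type} [Fintype ι]

/-- `𝓘_d(V)`: the homogeneous polynomials of degree `d` on `ℝ^ι` vanishing on `V ⊆ ℙ(ℝ^ι)`. -/
def vanishingForms (d : ℕ) (V : Set (ℙ ℝ (ι → ℝ))) : Submodule ℝ (MvPolynomial ι ℝ) where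
  carrier := {P | P.IsHomogeneous d ∧
    ∀ (v : ι → ℝ) (hv : v ≠ 0), Projectivization.mk ℝ v hv ∈ V → MvPolynomial.eval v P = 0}
  add_mem' := fun hP hQ => ⟨hP.1.add hQ.1, fun v hv hV => by
    rw [map_add, hP.2 v hv hV, hQ.2 v hv hV, add_zero]⟩
  zero_mem' := ⟨MvPolynomial.isHomogeneous_zero _ _ _, fun v _ _ => map_zero _⟩
  smul_mem' := fun c P hP => ⟨(MvPolynomial.homogeneousSubmodule ι ℝ d).smul_mem c hP.1,
    fun v hv hV => by rw [MvPolynomial.smul_eval, hP.2 v hv hV, mul_zero]⟩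

/-- The Zariski closure of a subset of `ℙ(ℝ^ι)`. -/
def zariskiClosure (V : Set (ℙ ℝ (ι → ℝ))) : Set (ℙ ℝ (ι → ℝ)) :=
  {p | ∀ (d : ℕ), ∀ P ∈ vanishingForms d V, MvPolynomial.eval p.rep P = 0}

/-- The projective subspace `ℙ(W) ⊆ ℙ(ℝ^ι)`. -/
def projSubspace (W : Submodule ℝ (ι → ℝ)) : Set (ℙ ℝ (ι → ℝ)) :=
  {p | p.submodule ≤ W}

/-- The `k`-th secant variety of `V`: the Zariski closure of the union of the projective subspaces
spanned by `k + 1` points of `V`. -/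
def secantVariety (k : ℕ) (V : Set (ℙ ℝ (ι → ℝ))) : Set (ℙ ℝ (ι → ℝ)) :=
  zariskiClosure (⋃ p : {p : Fin (k + 1) → ℙ ℝ (ι → ℝ) // ∀ i, p i ∈ V},
    projSubspace (⨆ i, (p.1 i).submodule))

/-- The `j`-th osculating subspace at time `t` of the curve in `ℙ(ℝ^ι)` represented by `γ`. -/
def osculatingSubspace (γ : ℝ → ι → ℝ) (j : ℕ) (t : ℝ) : Submodule ℝ (ι → ℝ) :=
  Submodule.span ℝ {v | ∃ i ≤ j, v = iteratedDeriv i γ t}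

/-- The `j`-th tangential developable of (the closure of) the curve represented by `γ`: the Zariski
closure of the union of the `j`-th osculating subspaces. -/
def tangentialDevelopable (j : ℕ) (γ : ℝ → ι → ℝ) : Set (ℙ ℝ (ι → ℝ)) :=
  zariskiClosure (⋃ t : ℝ, projSubspace (osculatingSubspace γ j t))

end Projective

/-- The orbit `t ↦ e^{tδ} f_{l-s}` in `F_{s,l}`; the closure in `ℙ F_{s,l}` of the corresponding
curve of lines is the rational normal curve `ℭ`. -/
def normalCurve (s l : ℤ) (t : ℝ) : F s l :=
  IsNilpotent.exp (t • Row.shift (-s) (l - s)) (Row.vec (-s) (l - s) (l - s))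

end

end FlagProlongation

namespace FlagProlongation

noncomputable section

/-! ### Coordinates, shifts and grading on a single row. -/

section

namespace Row

variable {a b : ℤ}

/-! Pairing the block `F → E` of an endomorphism of `X` with `F` through `σ` gives a bilinear form
on `F` (`formF`). The theorem then becomes a statement about classical prolongations of a space of
quadrics, in three steps.

Quadrics. Since `δ` is skew for `σ`, the derivative in `t` of the form of `A` at `(e^{tδ}x,
e^{tδ}y)` is the form of `[A, δ]` at the same vectors (`hasDerivAt_formF`). An `A` of degree `≥ 0`
pairs two vectors of positive degree to zero, so by induction on the degree every form coming from
`𝔲ᶠ` vanishes on each `e^{tδ}F_{>0}`, which is an osculating subspace of order `l - s - 1`.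
Conversely, a symmetric block `F → E` whose form vanishes on all these subspaces lies in `𝔲ᶠ`
(`mem_uF_of_formF_expShift`). Thus the symmetric `F → E` blocks in `𝔲ᶠ` are exactly the quadrics
through the developable.

Collapse. Elements of `𝔲ᶠ` preserve `E`, and their diagonal blocks lie in the image of `𝔤𝔩₂`
(`uF_blocks`). On a row of dimension `l + 1 ≥ 4` that image has zero first prolongation
(`gl2_prolongation_eq_zero`). Together with the vanishing on the curve this forces every element of
positive degree to kill `E` and the centre and to take values in `E` (`first_prolongation`,
`mem_symmProlongation_of_onX_mem`). What remains is the classical prolongation of the space of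
quadrics (`tanakaAux_eq_symmProlongation`).

Secants. Restricting the symmetric tensor `φ` to the diagonal gives a form of degree `k + 2` whose
partial derivatives are the forms of `φ(f_i)`, up to a constant. It is affine along directions in
which all the quadrics vanish, hence vanishes on sums of `k + 1` such vectors (`eval_sum_toPoly`).
Conversely, partial derivatives take forms vanishing on the `(k+1)`-st secant variety to forms
vanishing on the `k`-th, because the curve spans `F`; such a form is therefore integrated from its
partial derivatives by Euler's identity (`exists_toPoly_eq`). -/

theorem coeff_of_mem {i : ℤ} (h : i ∈ Finset.Icc a b) (x : Row a b) :
    coeff a b i x = x ⟨i, h⟩ := by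
  simp only [coeff, dif_pos h, LinearMap.proj_apply]

theorem coeff_of_notMem {i : ℤ} (h : i ∉ Finset.Icc a b) (x : Row a b) : coeff a b i x = 0 := by
  simp only [coeff, dif_neg h, LinearMap.zero_apply]

@[simp]
theorem coeff_coe (i : ↥(Finset.Icc a b)) (x : Row a b) : coeff a b (i : ℤ) x = x i :=
  coeff_of_mem i.2 x

theorem coeff_eq_zero_of_lt {i : ℤ} (h : i < a) (x : Row a b) : coeff a b i x = 0 :=
  coeff_of_notMem (by simp only [Finset.mem_Icc]; omega) x

theorem coeff_eq_zero_of_gt {i : ℤ} (h : b < i) (x : Row a b) : coeff a b i x = 0 :=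
  coeff_of_notMem (by simp only [Finset.mem_Icc]; omega) x

theorem ext_coeff {x y : Row a b} (h : ∀ i, a ≤ i → i ≤ b → coeff a b i x = coeff a b i y) :
    x = y := by
  funext i
  have hi := Finset.mem_Icc.mp i.2
  simpa using h i hi.1 hi.2

theorem coeff_vec (i j : ℤ) :
    coeff a b i (vec a b j) = if i = j ∧ a ≤ i ∧ i ≤ b then 1 else 0 := by
  by_cases h : i ∈ Finset.Icc a b
  · have h' := Finset.mem_Icc.mp h
    rw [coeff_of_mem h]
    simp [vec, h'.1, h'.2]
  · rw [coeff_of_notMem h, if_neg]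
    rw [Finset.mem_Icc] at h
    tauto

theorem coeff_vec_self {i : ℤ} (h₁ : a ≤ i) (h₂ : i ≤ b) : coeff a b i (vec a b i) = 1 := by
  simp [coeff_vec, h₁, h₂]

theorem coeff_vec_of_ne {i j : ℤ} (h : i ≠ j) : coeff a b i (vec a b j) = 0 := by
  simp [coeff_vec, h]

theorem vec_eq_zero_of_lt {i : ℤ} (h : i < a) : vec a b i = 0 := by
  refine ext_coeff fun j h₁ _ => ?_
  rw [coeff_vec_of_ne (by omega), map_zero]

theorem vec_eq_zero_of_gt {i : ℤ} (h : b < i) : vec a b i = 0 := by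
  refine ext_coeff fun j _ h₂ => ?_
  rw [coeff_vec_of_ne (by omega), map_zero]

theorem sum_vec (x : Row a b) : ∑ i : ↥(Finset.Icc a b), x i • vec a b i = x := by
  funext j
  simp only [Finset.sum_apply, Pi.smul_apply, vec, smul_eq_mul, mul_ite, mul_one, mul_zero]
  rw [Finset.sum_eq_single j]
  · simp
  · intro i _ hij
    rw [if_neg]
    exact fun h => hij (Subtype.ext h.symm)
  · simp

theorem linearMap_ext {M : Type*} [AddCommGroup M] [Module ℝ M] {f g : Row a b →ₗ[ℝ] M}
    (h : ∀ i, a ≤ i → i ≤ b → f (vec a b i) = g (vec a b i)) : f = g := by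
  refine LinearMap.ext fun x => ?_
  rw [← sum_vec x, map_sum, map_sum]
  refine Finset.sum_congr rfl fun i _ => ?_
  have hi := Finset.mem_Icc.mp i.2
  rw [map_smul, map_smul, h i hi.1 hi.2]

theorem coeff_shift {i : ℤ} (h : a ≤ i) (x : Row a b) :
    coeff a b i (shift a b x) = coeff a b (i + 1) x := by
  by_cases h' : i ≤ b
  · rw [coeff_of_mem (Finset.mem_Icc.mpr ⟨h, h'⟩)]
    simp [shift]
  · rw [coeff_eq_zero_of_gt (by omega), coeff_eq_zero_of_gt (by omega)]

theorem shift_vec {i : ℤ} (h : i ≤ b) : shift a b (vec a b i) = vec a b (i - 1) := by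
  refine ext_coeff fun j h₁ h₂ => ?_
  rw [coeff_shift h₁, coeff_vec, coeff_vec]
  congr 1
  simp only [eq_iff_iff]
  constructor <;> rintro ⟨h3, h4, h5⟩ <;> refine ⟨?_, ?_, ?_⟩ <;> omega

theorem coeff_shift_pow (n : ℕ) {i : ℤ} (h : a ≤ i) (x : Row a b) :
    coeff a b i ((shift a b ^ n) x) = coeff a b (i + n) x := by
  induction n generalizing x with
  | zero => simp
  | succ n ih =>
    rw [pow_succ, Module.End.mul_apply, ih, coeff_shift (by omega)]
    congr 2
    push_cast
    ring

theorem shift_pow_eq_zero {n : ℕ} (h : b - a < n) : shift a b ^ n = 0 := by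
  refine LinearMap.ext fun x => ?_
  refine ext_coeff fun i h₁ h₂ => ?_
  rw [coeff_shift_pow n h₁, coeff_eq_zero_of_gt (by omega)]
  simp

theorem shift_pow_vec (n : ℕ) {i : ℤ} (h : i ≤ b) :
    (shift a b ^ n) (vec a b i) = vec a b (i - n) := by
  induction n generalizing i with
  | zero => simp
  | succ n ih =>
    rw [pow_succ, Module.End.mul_apply, shift_vec h, ih (by omega)]
    congr 1
    push_cast
    ring

theorem mem_gr {i : ℤ} {x : Row a b} :
    x ∈ gr a b i ↔ ∀ j, j ≠ i → coeff a b j x = 0 := by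
  constructor
  · intro h j hj
    by_cases hm : j ∈ Finset.Icc a b
    · rw [coeff_of_mem hm]
      exact h ⟨j, hm⟩ hj
    · exact coeff_of_notMem hm x
  · intro h j hj
    simpa using h j hj

theorem vec_mem_gr (i : ℤ) : vec a b i ∈ gr a b i :=
  mem_gr.mpr fun _ hj => coeff_vec_of_ne hj

theorem eq_smul_vec_of_mem_gr {i : ℤ} {x : Row a b} (h : x ∈ gr a b i) :
    x = coeff a b i x • vec a b i := by
  refine ext_coeff fun j h₁ h₂ => ?_
  rw [map_smul, smul_eq_mul]
  by_cases hj : j = i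
  · subst hj
    rw [coeff_vec_self h₁ h₂, mul_one]
  · rw [mem_gr.mp h j hj, coeff_vec_of_ne hj, mul_zero]

theorem eq_zero_of_mem_gr {i : ℤ} {x : Row a b} (h : x ∈ gr a b i) (hi : i < a ∨ b < i) :
    x = 0 := by
  rw [eq_smul_vec_of_mem_gr h]
  rcases hi with hi | hi
  · rw [vec_eq_zero_of_lt hi, smul_zero]
  · rw [vec_eq_zero_of_gt hi, smul_zero]

end Row

end

/-! ### The first prolongation of `𝔤𝔩₂` acting on a row. -/

section

namespace Row

variable {a b : ℤ}

/-- The image of `𝔤𝔩₂` in the endomorphisms of a row, spanned by the shift, the grading operator,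
the identity and a raising operator. -/
def gl2 (a b : ℤ) : Submodule ℝ (Module.End ℝ (Row a b)) where
  carrier := {A | ∃ p h c r : ℝ, ∀ j : ℤ, a ≤ j → j ≤ b →
    A (vec a b j) = p • vec a b (j - 1) + (h * j + c) • vec a b j
      + (r * ((j - a + 1) * (b - j))) • vec a b (j + 1)}
  add_mem' := by
    rintro A B ⟨p, h, c, r, hA⟩ ⟨p', h', c', r', hB⟩
    refine ⟨p + p', h + h', c + c', r + r', fun j h₁ h₂ => ?_⟩
    rw [LinearMap.add_apply, hA j h₁ h₂, hB j h₁ h₂]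
    module
  zero_mem' := ⟨0, 0, 0, 0, fun j _ _ => by simp⟩
  smul_mem' := by
    rintro t A ⟨p, h, c, r, hA⟩
    refine ⟨t * p, t * h, t * c, t * r, fun j h₁ h₂ => ?_⟩
    rw [LinearMap.smul_apply, hA j h₁ h₂]
    module

/-- Every value of `ψ` is tridiagonal, while symmetry moves the entries to arbitrary distances from
the diagonal; comparing entries kills all parameters. The length bound matters: on a
three-dimensional row the image of `𝔤𝔩₂` is a conformal algebra, with nonzero first prolongation. -/
theorem gl2_prolongation_eq_zero (hab : 3 ≤ b - a) (ψ : Row a b →ₗ[ℝ] Module.End ℝ (Row a b))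
    (hψ : ∀ x, ψ x ∈ gl2 a b) (hs : ∀ x y, ψ x y = ψ y x) : ψ = 0 := by
  choose p h c r hA using fun i : ℤ => hψ (vec a b i)
  -- The two arguments have degrees `i` and `i + d`, and the coefficient in degree `i + d + o` is
  -- compared. So `o` is the offset from the second argument and `o + d` the offset from the first.
  have key : ∀ i d o : ℤ, a ≤ i → i ≤ b → a ≤ i + d → i + d ≤ b → a ≤ i + d + o → i + d + o ≤ b →
      (if o = -1 then p i else 0) + (if o = 0 then h i * ((i + d : ℤ) : ℝ) + c i else 0)
        + (if o = 1 then r i * (((i + d : ℤ) - a + 1 : ℝ) * (b - (i + d : ℤ))) else 0)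
      = (if o + d = -1 then p (i + d) else 0) + (if o + d = 0 then h (i + d) * i + c (i + d) else 0)
        + (if o + d = 1 then r (i + d) * ((i - a + 1 : ℝ) * (b - i)) else 0) := by
    intro i d o h1 h2 h3 h4 h5 h6
    have e := congrArg (coeff a b (i + d + o)) (hs (vec a b i) (vec a b (i + d)))
    rw [hA i _ h3 h4, hA (i + d) _ h1 h2] at e
    simp only [map_add, map_smul, coeff_vec, smul_eq_mul, h5, h6, and_self, and_true] at e
    have e1 : (i + d + o = i + d - 1) ↔ o = -1 := by omega
    have e2 : (i + d + o = i + d) ↔ o = 0 := by omega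
    have e3 : (i + d + o = i + d + 1) ↔ o = 1 := by omega
    have e4 : (i + d + o = i - 1) ↔ o + d = -1 := by omega
    have e5 : (i + d + o = i) ↔ o + d = 0 := by omega
    have e6 : (i + d + o = i + 1) ↔ o + d = 1 := by omega
    simpa only [e1, e2, e3, e4, e5, e6, mul_ite, mul_one, mul_zero] using e
  have hy : ∀ i : ℤ, a ≤ i → i < b → ((i - a + 1 : ℝ) * (b - i)) ≠ 0 := by
    intro i h1 h2
    have h1' : (a : ℝ) ≤ i := by exact_mod_cast h1
    have h2' : (i : ℝ) < b := by exact_mod_cast h2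
    exact mul_ne_zero (by linarith) (by linarith)
  have k1 : ∀ i, a ≤ i → i + 1 ≤ b → p i = h (i + 1) * i + c (i + 1) := fun i h1 h2 => by
    simpa using key i 1 (-1) h1 (by omega) (by omega) (by omega) (by omega) (by omega)
  have k2 : ∀ i : ℤ, a ≤ i → i + 1 ≤ b →
      h i * (i + 1) + c i = r (i + 1) * ((i - a + 1) * (b - i)) := fun i h1 h2 => by
    simpa using key i 1 0 h1 (by omega) (by omega) (by omega) (by omega) (by omega)
  have k3 : ∀ i : ℤ, a ≤ i → i + 2 ≤ b → r i = 0 := fun i h1 h2 => by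
    have h3 := hy (i + 1) (by omega) (by omega)
    have := key i 1 1 h1 (by omega) (by omega) (by omega) (by omega) (by omega)
    push_cast at this h3
    simpa [h3] using this
  have k4 : ∀ i : ℤ, a + 2 ≤ i → i ≤ b → p i = 0 := fun i h1 h2 => by
    simpa using (key (i - 1) 1 (-2) (by omega) (by omega) (by omega) (by omega) (by omega)
      (by omega)).symm
  have k5 : ∀ i : ℤ, a ≤ i → i + 2 ≤ b → p i = r (i + 2) * ((i - a + 1) * (b - i)) :=
    fun i h1 h2 => by
      simpa using key i 2 (-1) h1 (by omega) (by omega) (by omega) (by omega) (by omega)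
  have k6 : ∀ i : ℤ, a ≤ i → i + 2 ≤ b → h i * (i + 2) + c i = 0 := fun i h1 h2 => by
    simpa using key i 2 0 h1 (by omega) (by omega) (by omega) (by omega) (by omega)
  have k7 : ∀ i : ℤ, a ≤ i → i + 2 ≤ b → h (i + 2) * i + c (i + 2) = 0 := fun i h1 h2 => by
    simpa using (key i 2 (-2) h1 (by omega) (by omega) (by omega) (by omega) (by omega)).symm
  have k8 : p a = 0 := by
    simpa using key a 3 (-1) le_rfl (by omega) (by omega) (by omega) (by omega) (by omega)
  have k9 : ∀ d : ℤ, 3 ≤ d → a + d ≤ b → r (a + d) = 0 := fun d h1 h2 => by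
    have h3 := hy a (by omega) (by omega)
    have h4 : (b - a : ℝ) ≠ 0 := by simpa using h3
    have h5 : ¬ (1 - d = -1) := by omega
    have h6 : ¬ (1 - d = 0) := by omega
    have h7 : ¬ (1 - d = 1) := by omega
    have := key a d (1 - d) le_rfl (by omega) (by omega) (by omega) (by omega) (by omega)
    simpa [h5, h6, h7, h4] using this
  have hr2 : r (a + 2) = 0 := by
    have h3 := hy a (by omega) (by omega)
    have := k5 a le_rfl (by omega)
    rw [k8] at this
    exact (mul_eq_zero.mp this.symm).resolve_right h3
  have hr : ∀ i, a ≤ i → i ≤ b → r i = 0 := by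
    intro i h1 h2
    by_cases h3 : i + 2 ≤ b
    · exact k3 i h1 h3
    by_cases h4 : i = a + 2
    · rw [h4, hr2]
    have := k9 (i - a) (by omega) (by omega)
    rwa [add_sub_cancel] at this
  have hp : ∀ i, a ≤ i → i ≤ b → p i = 0 := by
    intro i h1 h2
    by_cases h3 : a + 2 ≤ i
    · exact k4 i h3 h2
    · rw [k5 i h1 (by omega), hr _ (by omega) (by omega), zero_mul]
  have hh : ∀ i, a ≤ i → i ≤ b → h i = 0 ∧ c i = 0 := by
    intro i h1 h2
    by_cases h3 : i + 2 ≤ b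
    · have e1 := k2 i h1 (by omega)
      rw [hr _ (by omega) (by omega), zero_mul] at e1
      have e2 := k6 i h1 h3
      have e3 : h i = 0 := by linarith
      exact ⟨e3, by rw [e3] at e1; linarith⟩
    · have e1 := k1 (i - 1) (by omega) (by omega)
      rw [hp _ (by omega) (by omega), sub_add_cancel] at e1
      have e2 := k7 (i - 2) (by omega) (by omega)
      rw [sub_add_cancel] at e2
      push_cast at e1 e2
      have e3 : h i = 0 := by linarith
      exact ⟨e3, by rw [e3] at e1; linarith⟩
  refine linearMap_ext fun i h1 h2 => linearMap_ext fun j h3 h4 => ?_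
  rw [hA i j h3 h4, hp i h1 h2, hr i h1 h2, (hh i h1 h2).1, (hh i h1 h2).2]
  simp

end Row

end

/-! ### Prolongation of the shift inside the endomorphisms of one row. -/

section

namespace Row

variable {a b : ℤ}

/-- The homogeneous components of `gl2`, where `n` is the degree plus one. -/
def IsGL2Component (n : ℕ) (A : Module.End ℝ (Row a b)) : Prop :=
  match n with
  | 0 => ∃ p : ℝ, ∀ j, a ≤ j → j ≤ b → A (vec a b j) = p • vec a b (j - 1)
  | 1 => ∃ h c : ℝ, ∀ j : ℤ, a ≤ j → j ≤ b → A (vec a b j) = (h * j + c) • vec a b j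
  | 2 => ∃ r : ℝ, ∀ j : ℤ, a ≤ j → j ≤ b →
      A (vec a b j) = (r * ((j - a + 1) * (b - j))) • vec a b (j + 1)
  | _ + 3 => A = 0

theorem IsGL2Component.mem_gl2 {n : ℕ} {A : Module.End ℝ (Row a b)} (hA : IsGL2Component n A) :
    A ∈ gl2 a b := by
  match n with
  | 0 =>
    obtain ⟨p, hp⟩ := hA
    exact ⟨p, 0, 0, 0, fun j h1 h2 => by rw [hp j h1 h2]; simp⟩
  | 1 =>
    obtain ⟨h, c, hp⟩ := hA
    exact ⟨0, h, c, 0, fun j h1 h2 => by rw [hp j h1 h2]; simp⟩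
  | 2 =>
    obtain ⟨r, hp⟩ := hA
    exact ⟨0, 0, 0, r, fun j h1 h2 => by rw [hp j h1 h2]; simp⟩
  | m + 3 =>
    have hA : A = 0 := hA
    rw [hA]
    exact Submodule.zero_mem _

theorem coeff_commutator (A : Module.End ℝ (Row a b)) (k : ℤ) {j : ℤ} (h₁ : j ≤ b)
    (h₂ : a ≤ j + k - 1) :
    coeff a b (j + k - 1) ((A * shift a b - shift a b * A) (vec a b j)) =
      coeff a b (j - 1 + k) (A (vec a b (j - 1))) - coeff a b (j + k) (A (vec a b j)) := by
  rw [LinearMap.sub_apply, Module.End.mul_apply, Module.End.mul_apply, shift_vec h₁, map_sub,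
    coeff_shift h₂, sub_add_cancel]
  congr 3
  ring

/-- A homogeneous `A` is a sequence `α`, and the commutator with the shift is its difference
sequence. Summation from the bottom determines `α`; its vanishing at the top of the row is the
obstruction that stops the prolongation after degree 1. -/
theorem IsGL2Component.succ (hab : a < b) {n : ℕ} {A : Module.End ℝ (Row a b)}
    (hd : ∀ j, a ≤ j → j ≤ b → A (vec a b j) ∈ gr a b (j + n))
    (hA : IsGL2Component n (A * shift a b - shift a b * A)) : IsGL2Component (n + 1) A := by
  set α : ℤ → ℝ := fun j => coeff a b (j + n) (A (vec a b j)) with hα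
  have hAα : ∀ j, a ≤ j → j ≤ b → A (vec a b j) = α j • vec a b (j + n) := fun j h1 h2 =>
    eq_smul_vec_of_mem_gr (hd j h1 h2)
  have hstep : ∀ j, a ≤ j → j ≤ b → a ≤ j + n - 1 → α (j - 1) - α j =
      coeff a b (j + n - 1) ((A * shift a b - shift a b * A) (vec a b j)) := fun j h1 h2 h3 =>
    (coeff_commutator A n h2 h3).symm
  -- The index `a - 1` lies outside the row; including it turns the lower boundary condition into an
  -- initial value for the recursion.
  have h0 : α (a - 1) = 0 := by
    simp only [hα]
    rw [vec_eq_zero_of_lt (by omega), map_zero, map_zero]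
  have hgt : ∀ j : ℤ, b < j + n → α j = 0 := fun j h => coeff_eq_zero_of_gt h _
  match n with
  | 0 =>
    obtain ⟨p, hp⟩ := hA
    have hform : ∀ j : ℤ, a ≤ j → j ≤ b → α j = α a - p * (j - a) := by
      intro j h1
      induction j, h1 using Int.leInduction with
      | base => simp
      | succ m h1 ih =>
        intro h2
        have e := hstep (m + 1) (by omega) h2 (by simpa using h1)
        rw [hp _ (by omega) h2, map_smul, add_sub_cancel_right,
          show m + 1 + ((0 : ℕ) : ℤ) - 1 = m by simp, coeff_vec_self h1 (by omega),
          ih (by omega)] at e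
        push_cast
        simp only [smul_eq_mul] at e
        linarith
    refine ⟨-p, α a + p * a, fun j h1 h2 => ?_⟩
    rw [hAα j h1 h2, hform j h1 h2]
    simp only [Nat.cast_zero, add_zero]
    congr 1
    ring
  | 1 =>
    obtain ⟨h, c, hp⟩ := hA
    have hs : ∀ j, a ≤ j → j ≤ b → α (j - 1) - α j = h * j + c := by
      intro j h1 h2
      rw [hstep j h1 h2 (by push_cast; omega), hp j h1 h2, map_smul,
        show j + ((1 : ℕ) : ℤ) - 1 = j by simp, coeff_vec_self h1 h2]
      simp
    have hform : ∀ j : ℤ, a ≤ j → j ≤ b → α j = -(j - a + 1) * (h * (a + j) / 2 + c) := by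
      intro j h1
      induction j, h1 using Int.leInduction with
      | base =>
        intro h2
        have e := hs a le_rfl h2
        rw [h0] at e
        linarith
      | succ m h1 ih =>
        intro h2
        have e := hs (m + 1) (by omega) h2
        rw [add_sub_cancel_right, ih (by omega)] at e
        push_cast at e ⊢
        linarith
    -- In degree 1 the image of the top vector leaves the row, so the diagonal commutator must have
    -- trace zero. This turns the quadratic `α` into a multiple of `(j - a + 1)(b - j)`.
    have hb : h * (a + b) / 2 + c = 0 := by
      have e := hform b hab.le le_rfl
      rw [hgt b (by simp)] at e
      have hab' : (a : ℝ) < b := by exact_mod_cast hab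
      exact (mul_eq_zero.mp e.symm).resolve_left (by linarith)
    refine ⟨h / 2, fun j h1 h2 => ?_⟩
    rw [hAα j h1 h2, hform j h1 h2, show c = -(h * (a + b) / 2) by linarith]
    simp only [Nat.cast_one]
    congr 1
    ring
  | 2 =>
    obtain ⟨r, hp⟩ := hA
    have hs : ∀ j, a ≤ j → j ≤ b - 1 → α (j - 1) - α j = r * ((j - a + 1) * (b - j)) := by
      intro j h1 h2
      rw [hstep j h1 (by omega) (by push_cast; omega), hp j h1 (by omega), map_smul,
        show j + ((2 : ℕ) : ℤ) - 1 = j + 1 by push_cast; ring,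
        coeff_vec_self (by omega) (by omega)]
      simp
    have hform : ∀ j : ℤ, a ≤ j → j ≤ b - 1 → ∃ S : ℝ, 0 < S ∧ α j = -r * S := by
      intro j h1
      have hpos : ∀ i : ℤ, a ≤ i → i ≤ b - 1 → 0 < ((i - a + 1) * (b - i) : ℝ) := by
        intro i h1 h2
        have h1' : (a : ℝ) ≤ i := by exact_mod_cast h1
        have h2' : (i : ℝ) ≤ b - 1 := by exact_mod_cast h2
        exact mul_pos (by linarith) (by linarith)
      induction j, h1 using Int.leInduction with
      | base =>
        intro h2
        have e := hs a le_rfl h2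
        rw [h0] at e
        exact ⟨_, hpos a le_rfl h2, by linarith⟩
      | succ m h1 ih =>
        intro h2
        obtain ⟨S, hS, hαS⟩ := ih (by omega)
        have e := hs (m + 1) (by omega) h2
        rw [add_sub_cancel_right, hαS] at e
        exact ⟨_, add_pos hS (hpos (m + 1) (by omega) h2), by linarith⟩
    -- In degree 2 already `α (b - 1)` must vanish, but it is `-r` times a sum of positive terms.
    have hr : r = 0 := by
      obtain ⟨S, hS, e⟩ := hform (b - 1) (by omega) le_rfl
      rw [hgt (b - 1) (by push_cast; omega)] at e
      simpa [hS.ne'] using e.symm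
    refine linearMap_ext fun j h1 h2 => ?_
    rw [hAα j h1 h2]
    by_cases h3 : j ≤ b - 1
    · obtain ⟨S, -, e⟩ := hform j h1 h3
      rw [e, hr]
      simp
    · rw [hgt j (by push_cast; omega)]
      simp
  | m + 3 =>
    have hA : A * shift a b - shift a b * A = 0 := hA
    have hform : ∀ j : ℤ, a ≤ j → j ≤ b → α j = 0 := by
      intro j h1
      induction j, h1 using Int.leInduction with
      | base =>
        intro h2
        have e := hstep a le_rfl h2 (by push_cast; omega)
        rw [hA, h0] at e
        simpa using e
      | succ i h1 ih =>
        intro h2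
        have e := hstep (i + 1) (by omega) h2 (by push_cast; omega)
        rw [hA, add_sub_cancel_right, ih (by omega)] at e
        simpa using e
    refine linearMap_ext fun j h1 h2 => ?_
    rw [hAα j h1 h2, hform j h1 h2]
    simp

/-- The top vector is cyclic for the shift, so an intertwiner is determined by its value there. -/
theorem eq_zero_of_comp_shift_eq {a' b' : ℤ} {G : Row a b →ₗ[ℝ] Row a' b'}
    (hG : G ∘ₗ shift a b = shift a' b' ∘ₗ G) (hb : G (vec a b b) = 0) : G = 0 := by
  refine linearMap_ext fun j h1 h2 => ?_
  rw [LinearMap.zero_apply]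
  induction j, h2 using Int.leInductionDown with
  | base => exact hb
  | pred m h2 ih =>
    have e := LinearMap.congr_fun hG (vec a b m)
    rwa [LinearMap.comp_apply, LinearMap.comp_apply, shift_vec h2, ih (by omega), map_zero] at e

end Row

end

section

/-! ### The pairing of the two rows -/

/-- The pairing `E × F → ℝ` defined by the symplectic form. -/
def tau (s l : ℤ) : E s l →ₗ[ℝ] F s l →ₗ[ℝ] ℝ :=
  (sigmaX s l).compl₁₂ (LinearMap.inl ℝ (E s l) (F s l)) (LinearMap.inr ℝ (E s l) (F s l))

variable {s l : ℤ}

theorem tau_apply (e : E s l) (f : F s l) :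
    tau s l e f = ∑ i : ↥(Finset.Icc (s - l) s), (-1 : ℝ) ^ (s - (i : ℤ)) *
      (e i * Row.coeff (-s) (l - s) (-(i : ℤ)) f) := by
  simp [tau, sigmaX]

theorem sigmaX_apply (x y : XX s l) :
    sigmaX s l x y = tau s l x.1 y.2 - tau s l y.1 x.2 := by
  rw [tau_apply, tau_apply, ← Finset.sum_sub_distrib]
  simp only [sigmaX, LinearMap.mk₂_apply]
  exact Finset.sum_congr rfl fun i _ => by ring

theorem tau_vec_left {i : ℤ} (h₁ : s - l ≤ i) (h₂ : i ≤ s) (f : F s l) :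
    tau s l (Row.vec (s - l) s i) f = (-1) ^ (s - i) * Row.coeff (-s) (l - s) (-i) f := by
  rw [tau_apply, Finset.sum_eq_single ⟨i, Finset.mem_Icc.mpr ⟨h₁, h₂⟩⟩]
  · simp [Row.vec]
  · intro j _ hj
    have : (j : ℤ) ≠ i := fun h => hj (Subtype.ext h)
    simp [Row.vec, this]
  · simp

theorem tau_vec_right {j : ℤ} (h₁ : -s ≤ j) (h₂ : j ≤ l - s) (e : E s l) :
    tau s l e (Row.vec (-s) (l - s) j) = (-1) ^ (s + j) * Row.coeff (s - l) s (-j) e := by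
  have : (tau s l).flip (Row.vec (-s) (l - s) j) =
      ((-1 : ℝ) ^ (s + j)) • Row.coeff (s - l) s (-j) := by
    refine Row.linearMap_ext fun i h3 h4 => ?_
    rw [LinearMap.flip_apply, tau_vec_left h3 h4, LinearMap.smul_apply, smul_eq_mul,
      Row.coeff_vec, Row.coeff_vec]
    by_cases h : i = -j
    · subst h
      rw [if_pos (by omega), if_pos (by omega), sub_neg_eq_add]
    · rw [if_neg (by omega), if_neg (by omega), mul_zero, mul_zero]
  exact LinearMap.congr_fun this e

theorem neg_one_zpow_ne_zero (n : ℤ) : (-1 : ℝ) ^ n ≠ 0 := zpow_ne_zero _ (by norm_num)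

theorem eq_zero_of_tau_right {e : E s l} (h : ∀ f, tau s l e f = 0) : e = 0 := by
  refine Row.ext_coeff fun i h1 h2 => ?_
  have := h (Row.vec (-s) (l - s) (-i))
  rw [tau_vec_right (by omega) (by omega), neg_neg] at this
  rw [map_zero]
  exact (mul_eq_zero.mp this).resolve_left (neg_one_zpow_ne_zero _)

theorem eq_zero_of_tau_left {f : F s l} (h : ∀ e, tau s l e f = 0) : f = 0 := by
  refine Row.ext_coeff fun i h1 h2 => ?_
  have := h (Row.vec (s - l) s (-i))
  rw [tau_vec_left (by omega) (by omega), neg_neg] at this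
  rw [map_zero]
  exact (mul_eq_zero.mp this).resolve_left (neg_one_zpow_ne_zero _)

/-- The alternating signs in `σ` are what make `δ` skew. -/
theorem tau_shift (e : E s l) (f : F s l) :
    tau s l (Row.shift (s - l) s e) f = -tau s l e (Row.shift (-s) (l - s) f) := by
  have : tau s l ∘ₗ Row.shift (s - l) s =
      -(tau s l).compl₁₂ LinearMap.id (Row.shift (-s) (l - s)) := by
    refine Row.linearMap_ext fun i h1 h2 => Row.linearMap_ext fun j h3 h4 => ?_
    simp only [LinearMap.comp_apply, LinearMap.neg_apply, LinearMap.compl₁₂_apply,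
      LinearMap.id_apply]
    rw [Row.shift_vec h2, Row.shift_vec h4, tau_vec_right h3 h4, tau_vec_left h1 h2,
      Row.coeff_vec, Row.coeff_vec]
    by_cases h : i + j = 1
    · rw [if_pos (by omega), if_pos (by omega), show s + j = s - i + 1 by omega,
        zpow_add₀ (by norm_num)]
      simp
    · rw [if_neg (by omega), if_neg (by omega)]
      simp
  exact LinearMap.congr_fun (LinearMap.congr_fun this e) f

theorem tau_eq_zero_of_coeff {e : E s l} {f : F s l}
    (h : ∀ i, s - l ≤ i → i ≤ s → Row.coeff (s - l) s i e = 0 ∨ Row.coeff (-s) (l - s) (-i) f = 0) :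
    tau s l e f = 0 := by
  rw [tau_apply]
  refine Finset.sum_eq_zero fun i _ => ?_
  have hi := Finset.mem_Icc.mp i.2
  rcases h i hi.1 hi.2 with h | h
  · rw [Row.coeff_coe] at h
    rw [h, zero_mul, mul_zero]
  · rw [h, mul_zero, mul_zero]

/-! ### Blocks of the universal prolongation -/

/-- The block `E → E` of an endomorphism. -/
def blockEE (A : Module.End ℝ (XX s l)) : Module.End ℝ (E s l) :=
  LinearMap.fst ℝ _ _ ∘ₗ A ∘ₗ LinearMap.inl ℝ _ _

/-- The block `F → F` of an endomorphism. -/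
def blockFF (A : Module.End ℝ (XX s l)) : Module.End ℝ (F s l) :=
  LinearMap.snd ℝ _ _ ∘ₗ A ∘ₗ LinearMap.inr ℝ _ _

@[simp]
theorem blockEE_apply (A : Module.End ℝ (XX s l)) (e : E s l) : blockEE A e = (A (e, 0)).1 := rfl

@[simp]
theorem blockFF_apply (A : Module.End ℝ (XX s l)) (f : F s l) : blockFF A f = (A (0, f)).2 := rfl

@[simp]
theorem deltaX_apply (x : XX s l) :
    deltaX s l x = (Row.shift (s - l) s x.1, Row.shift (-s) (l - s) x.2) := rfl

end

section

variable {s l : ℤ}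


theorem mem_uFComponent_succ {n : ℕ} {A : Module.End ℝ (XX s l)} :
    A ∈ uFComponent (sigmaX s l) (gradingX s l) (deltaX s l) (n + 1) ↔
      (A ∈ csp (sigmaX s l) ∧ A ∈ endDegree (gradingX s l) n) ∧
        A * deltaX s l - deltaX s l * A ∈
          uFComponent (sigmaX s l) (gradingX s l) (deltaX s l) n := Iff.rfl

/-- Each block of `[A, δ]` appearing here is the commutator of the same block of `A` with the
shifts, because `δ` is block diagonal. Hence the induction runs block by block; the block `E → F`
becomes an intertwiner. -/
theorem uFComponent_blocks (hsl : s < l) (hls : l < 2 * s) {n : ℕ} {A : Module.End ℝ (XX s l)}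
    (hA : A ∈ uFComponent (sigmaX s l) (gradingX s l) (deltaX s l) n) :
    (∀ e, (A (e, 0)).2 = 0) ∧ Row.IsGL2Component n (blockEE A) ∧
      Row.IsGL2Component n (blockFF A) := by
  induction n generalizing A with
  | zero =>
    obtain ⟨c, rfl⟩ := Submodule.mem_span_singleton.mp hA
    refine ⟨fun e => by simp, ⟨c, fun j _ h2 => ?_⟩, ⟨c, fun j _ h2 => ?_⟩⟩
    · simp [Row.shift_vec h2]
    · simp [Row.shift_vec h2]
  | succ n ih =>
    obtain ⟨⟨-, hd⟩, hc⟩ := mem_uFComponent_succ.mp hA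
    obtain ⟨h1, h2, h3⟩ := ih hc
    have hEE : blockEE (A * deltaX s l - deltaX s l * A) =
        blockEE A * Row.shift (s - l) s - Row.shift (s - l) s * blockEE A := by
      refine LinearMap.ext fun e => ?_
      simp
    have hFF : blockFF (A * deltaX s l - deltaX s l * A) =
        blockFF A * Row.shift (-s) (l - s) - Row.shift (-s) (l - s) * blockFF A := by
      refine LinearMap.ext fun e => ?_
      simp
    have hdE : ∀ j, A (Row.vec (s - l) s j, 0) ∈ gradingX s l (j + n) := fun j =>
      hd j _ ⟨Row.vec_mem_gr j, Submodule.zero_mem _⟩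
    have hdF : ∀ j, A (0, Row.vec (-s) (l - s) j) ∈ gradingX s l (j + n) := fun j =>
      hd j _ ⟨Submodule.zero_mem _, Row.vec_mem_gr j⟩
    refine ⟨fun e => ?_, ?_, ?_⟩
    · have : LinearMap.snd ℝ _ _ ∘ₗ A ∘ₗ LinearMap.inl ℝ (E s l) (F s l) = 0 := by
        refine Row.eq_zero_of_comp_shift_eq (LinearMap.ext fun e => ?_) ?_
        · simpa [sub_eq_zero] using h1 e
        -- The image of `e_s` has degree `s + n`, above the top degree `l - s` of `F` because `l <
        -- 2s`.
        · exact Row.eq_zero_of_mem_gr (hdE s).2 (Or.inr (by omega))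
      exact LinearMap.congr_fun this e
    · rw [hEE] at h2
      exact Row.IsGL2Component.succ (by omega) (fun j _ _ => (hdE j).1) h2
    · rw [hFF] at h3
      exact Row.IsGL2Component.succ (by omega) (fun j _ _ => (hdF j).2) h3

theorem uF_blocks (hsl : s < l) (hls : l < 2 * s) {A : Module.End ℝ (XX s l)}
    (hA : A ∈ uF (sigmaX s l) (gradingX s l) (deltaX s l)) :
    (∀ e, (A (e, 0)).2 = 0) ∧ blockEE A ∈ Row.gl2 (s - l) s ∧
      blockFF A ∈ Row.gl2 (-s) (l - s) := by
  induction hA using Submodule.iSup_induction' with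
  | mem n A hA =>
    obtain ⟨h1, h2, h3⟩ := uFComponent_blocks hsl hls hA
    exact ⟨h1, h2.mem_gl2, h3.mem_gl2⟩
  | zero => exact ⟨fun _ => rfl, Submodule.zero_mem _, Submodule.zero_mem _⟩
  | add A B _ _ hA hB =>
    exact ⟨fun e => by rw [LinearMap.add_apply, Prod.snd_add, hA.1, hB.1, add_zero],
      Submodule.add_mem _ hA.2.1 hB.2.1, Submodule.add_mem _ hA.2.2 hB.2.2⟩

/-! ### The orbits of the one-parameter group generated by the shift -/

namespace Row

variable {a b : ℤ}

/-- The exponential of `t` times the shift. -/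
def expShift (a b : ℤ) (t : ℝ) : Module.End ℝ (Row a b) :=
  ∑ i ∈ Finset.range ((b - a).toNat + 1), (t ^ i / (i.factorial : ℝ)) • shift a b ^ i

theorem shift_pow_toNat : shift a b ^ ((b - a).toNat + 1) = 0 :=
  shift_pow_eq_zero (by push_cast; omega)

theorem expShift_eq_exp (t : ℝ) : expShift a b t = IsNilpotent.exp (t • shift a b) := by
  rw [IsNilpotent.exp_eq_sum (k := (b - a).toNat + 1)
    (by rw [smul_pow, shift_pow_toNat, smul_zero])]
  refine Finset.sum_congr rfl fun i _ => ?_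
  rw [smul_pow, ← Rat.cast_smul_eq_qsmul ℝ, smul_smul]
  congr 1
  push_cast
  ring

theorem expShift_apply (t : ℝ) (x : Row a b) : expShift a b t x =
    ∑ i ∈ Finset.range ((b - a).toNat + 1), (t ^ i / (i.factorial : ℝ)) • (shift a b ^ i) x := by
  simp [expShift, LinearMap.sum_apply]

@[simp]
theorem expShift_zero (x : Row a b) : expShift a b 0 x = x := by
  rw [expShift_apply, Finset.sum_range_succ']
  simp

theorem hasDerivAt_expShift (x : Row a b) (t : ℝ) :
    HasDerivAt (fun t => expShift a b t x) (expShift a b t (shift a b x)) t := by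
  have h : HasDerivAt (fun t => ∑ i ∈ Finset.range ((b - a).toNat + 1),
      (t ^ i / (i.factorial : ℝ)) • (shift a b ^ i) x)
      (∑ i ∈ Finset.range ((b - a).toNat + 1),
        (i * t ^ (i - 1) / (i.factorial : ℝ)) • (shift a b ^ i) x) t :=
    HasDerivAt.fun_sum fun i _ => ((hasDerivAt_pow i t).div_const _).smul_const _
  simp only [expShift_apply]
  convert h using 1
  rw [Finset.sum_range_succ, Finset.sum_range_succ', ← Module.End.mul_apply (shift a b ^ _),
    ← pow_succ, shift_pow_toNat]
  simp only [LinearMap.zero_apply, smul_zero, add_zero, Nat.cast_zero, zero_mul, zero_div, zero_smul]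
  refine Finset.sum_congr rfl fun i _ => ?_
  rw [← Module.End.mul_apply (shift a b ^ _), ← pow_succ, Nat.factorial_succ]
  congr 1
  have : (i.factorial : ℝ) ≠ 0 := by positivity
  push_cast
  field_simp

theorem iteratedDeriv_expShift (n : ℕ) (x : Row a b) (t : ℝ) :
    iteratedDeriv n (fun t => expShift a b t x) t = expShift a b t ((shift a b ^ n) x) := by
  induction n generalizing t with
  | zero => simp
  | succ n ih =>
    rw [iteratedDeriv_succ, funext ih, (hasDerivAt_expShift _ t).deriv, pow_succ',
      Module.End.mul_apply]

/-- The vectors of positive degree. -/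
def pos (a b : ℤ) : Submodule ℝ (Row a b) :=
  Submodule.span ℝ {x | ∃ i, 1 ≤ i ∧ i ≤ b ∧ x = vec a b i}

theorem vec_mem_pos {i : ℤ} (h₁ : 1 ≤ i) (h₂ : i ≤ b) : vec a b i ∈ pos a b :=
  Submodule.subset_span ⟨i, h₁, h₂, rfl⟩

end Row

/-- The derivatives of order `0, …, l - s - 1` are the translates by `e^{tδ}` of `f_{l-s}, …, f_1`,
the vectors of positive degree. -/
theorem osculatingSubspace_normalCurve (hsl : s < l) (t : ℝ) :
    osculatingSubspace (normalCurve s l) (l - s - 1).toNat t =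
      (Row.pos (-s) (l - s)).map (Row.expShift (-s) (l - s) t) := by
  have hγ : normalCurve s l = fun t => Row.expShift (-s) (l - s) t (Row.vec (-s) (l - s) (l - s)) := by
    funext t
    rw [Row.expShift_eq_exp]
    rfl
  rw [osculatingSubspace, Row.pos, Submodule.map_span, hγ]
  congr 1
  ext v
  constructor
  · rintro ⟨i, hi, rfl⟩
    rw [Row.iteratedDeriv_expShift, Row.shift_pow_vec i le_rfl]
    exact ⟨_, ⟨l - s - i, by omega, by omega, rfl⟩, rfl⟩
  · rintro ⟨_, ⟨i, h1, h2, rfl⟩, rfl⟩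
    refine ⟨(l - s - i).toNat, by omega, ?_⟩
    rw [Row.iteratedDeriv_expShift, Row.shift_pow_vec _ le_rfl]
    congr 2
    omega

/-! ### Forms from the universal prolongation vanish on the osculating subspaces. -/

theorem hasDerivAt_bilin {V : Type*} [NormedAddCommGroup V] [NormedSpace ℝ V]
    [FiniteDimensional ℝ V] (B : V →ₗ[ℝ] V →ₗ[ℝ] ℝ) {u v : ℝ → V} {u' v' : V} {t : ℝ}
    (hu : HasDerivAt u u' t) (hv : HasDerivAt v v' t) :
    HasDerivAt (fun t => B (u t) (v t)) (B (u t) v' + B u' (v t)) t :=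
  B.toContinuousBilinearMap.hasDerivAt_of_bilinear (fun _ => hu) (fun _ => hv)

/-- The bilinear form on `F` defined by the block `F → E` of an endomorphism of `X`. -/
def formF (A : Module.End ℝ (XX s l)) : F s l →ₗ[ℝ] F s l →ₗ[ℝ] ℝ :=
  tau s l ∘ₗ LinearMap.fst ℝ _ _ ∘ₗ A ∘ₗ LinearMap.inr ℝ _ _

theorem formF_apply (A : Module.End ℝ (XX s l)) (x y : F s l) :
    formF A x y = tau s l (A (0, x)).1 y := rfl

theorem formF_commutator (A : Module.End ℝ (XX s l)) (x y : F s l) :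
    formF (A * deltaX s l - deltaX s l * A) x y =
      formF A (Row.shift (-s) (l - s) x) y + formF A x (Row.shift (-s) (l - s) y) := by
  simp only [formF_apply, LinearMap.sub_apply, Module.End.mul_apply, deltaX_apply, Prod.fst_sub,
    map_sub, map_zero, tau_shift]
  ring

theorem hasDerivAt_formF (A : Module.End ℝ (XX s l)) (x y : F s l) (t : ℝ) :
    HasDerivAt (fun t => formF A (Row.expShift (-s) (l - s) t x) (Row.expShift (-s) (l - s) t y))
      (formF (A * deltaX s l - deltaX s l * A) (Row.expShift (-s) (l - s) t x)
        (Row.expShift (-s) (l - s) t y)) t := by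
  have hcomm : ∀ z, Row.shift (-s) (l - s) (Row.expShift (-s) (l - s) t z) =
      Row.expShift (-s) (l - s) t (Row.shift (-s) (l - s) z) := by
    intro z
    simp only [Row.expShift_apply, map_sum, map_smul]
    refine Finset.sum_congr rfl fun i _ => ?_
    rw [← Module.End.mul_apply, ← pow_succ', pow_succ, Module.End.mul_apply]
  convert hasDerivAt_bilin (formF A) (Row.hasDerivAt_expShift x t) (Row.hasDerivAt_expShift y t)
    using 1
  rw [formF_commutator, hcomm, hcomm, add_comm]

theorem formF_pos_eq_zero {n : ℕ} {A : Module.End ℝ (XX s l)}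
    (hA : A ∈ endDegree (gradingX s l) n) {x y : F s l} (hx : x ∈ Row.pos (-s) (l - s))
    (hy : y ∈ Row.pos (-s) (l - s)) : formF A x y = 0 := by
  induction hx, hy using Submodule.span_induction₂ with
  | mem_mem x y hx hy =>
    obtain ⟨i, h1, h2, rfl⟩ := hx
    obtain ⟨j, h3, h4, rfl⟩ := hy
    rw [formF_apply]
    have hi := (hA i (0, Row.vec (-s) (l - s) i) ⟨Submodule.zero_mem _, Row.vec_mem_gr i⟩).1
    refine tau_eq_zero_of_coeff fun m _ _ => ?_
    by_cases hm : m = i + n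
    · exact Or.inr (Row.coeff_vec_of_ne (by omega))
    · exact Or.inl (Row.mem_gr.mp hi m hm)
  | zero_left => simp
  | zero_right => simp
  | add_left _ _ _ _ _ _ h1 h2 => rw [map_add, LinearMap.add_apply, h1, h2, add_zero]
  | add_right _ _ _ _ _ _ h1 h2 => rw [map_add, h1, h2, add_zero]
  | smul_left _ _ _ _ _ h => rw [map_smul, LinearMap.smul_apply, h, smul_zero]
  | smul_right _ _ _ _ _ h => rw [map_smul, h, smul_zero]

/-- By induction the derivative in `t`, given by `[A, δ]`, vanishes; the value at `t = 0` vanishes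
by degree. The line `ℝδ` has no block `F → E`. -/
theorem formF_expShift_eq_zero_of_mem_uFComponent {n : ℕ} {A : Module.End ℝ (XX s l)}
    (hA : A ∈ uFComponent (sigmaX s l) (gradingX s l) (deltaX s l) n) (t : ℝ) {x y : F s l}
    (hx : x ∈ Row.pos (-s) (l - s)) (hy : y ∈ Row.pos (-s) (l - s)) :
    formF A (Row.expShift (-s) (l - s) t x) (Row.expShift (-s) (l - s) t y) = 0 := by
  induction n generalizing A t with
  | zero =>
    obtain ⟨c, rfl⟩ := Submodule.mem_span_singleton.mp hA
    simp [formF_apply]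
  | succ n ih =>
    obtain ⟨⟨-, hd⟩, hc⟩ := mem_uFComponent_succ.mp hA
    have hderiv : ∀ t, HasDerivAt (fun t => formF A (Row.expShift (-s) (l - s) t x)
        (Row.expShift (-s) (l - s) t y)) 0 t := fun t => by
      simpa only [ih hc t] using hasDerivAt_formF A x y t
    have := is_const_of_deriv_eq_zero (fun t => (hderiv t).differentiableAt)
      (fun t => (hderiv t).deriv) t 0
    rw [this, Row.expShift_zero, Row.expShift_zero, formF_pos_eq_zero hd hx hy]

theorem formF_expShift_eq_zero_of_mem_uF {A : Module.End ℝ (XX s l)}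
    (hA : A ∈ uF (sigmaX s l) (gradingX s l) (deltaX s l)) (t : ℝ) {x y : F s l}
    (hx : x ∈ Row.pos (-s) (l - s)) (hy : y ∈ Row.pos (-s) (l - s)) :
    formF A (Row.expShift (-s) (l - s) t x) (Row.expShift (-s) (l - s) t y) = 0 := by
  induction hA using Submodule.iSup_induction' with
  | mem n A hA => exact formF_expShift_eq_zero_of_mem_uFComponent hA t hx hy
  | zero => simp [formF_apply]
  | add A B _ _ hA hB =>
    rw [formF_apply] at hA hB ⊢
    rw [LinearMap.add_apply, Prod.fst_add, map_add, LinearMap.add_apply, hA, hB, add_zero]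

end

/-! ### Symmetric forms vanishing on the osculating subspaces lie in the universal prolongation. -/

section

variable {s l : ℤ}

theorem Row.shift_mem_gr {a b i : ℤ} {x : Row a b} (hx : x ∈ Row.gr a b i) :
    Row.shift a b x ∈ Row.gr a b (i - 1) := by
  refine Row.mem_gr.mpr fun j hj => ?_
  by_cases h : a ≤ j
  · rw [Row.coeff_shift h, Row.mem_gr.mp hx _ (by omega)]
  · exact Row.coeff_eq_zero_of_lt (by omega) _

theorem formF_add (A B : Module.End ℝ (XX s l)) (x y : F s l) :
    formF (A + B) x y = formF A x y + formF B x y := by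
  simp [formF_apply]

theorem formF_sub (A B : Module.End ℝ (XX s l)) (x y : F s l) :
    formF (A - B) x y = formF A x y - formF B x y := by
  simp [formF_apply]

theorem formF_smul (c : ℝ) (A : Module.End ℝ (XX s l)) (x y : F s l) :
    formF (c • A) x y = c * formF A x y := by
  simp [formF_apply]

theorem formF_sum {ι : Type*} (S : Finset ι) (A : ι → Module.End ℝ (XX s l)) (x y : F s l) :
    formF (∑ i ∈ S, A i) x y = ∑ i ∈ S, formF (A i) x y := by
  simp [formF_apply, LinearMap.sum_apply, Prod.fst_sum]

/-- The endomorphisms `X → F → E → X` that correspond to symmetric bilinear forms on `F`. -/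
def symmBlock (s l : ℤ) : Submodule ℝ (Module.End ℝ (XX s l)) where
  carrier := {A | (∀ e, A (e, 0) = 0) ∧ (∀ f, (A (0, f)).2 = 0) ∧
    ∀ x y, formF A x y = formF A y x}
  add_mem' := fun {A B} hA hB => ⟨fun e => by simp [hA.1, hB.1], fun f => by simp [hA.2.1, hB.2.1],
    fun x y => by rw [formF_add, formF_add, hA.2.2, hB.2.2]⟩
  zero_mem' := ⟨fun _ => rfl, fun _ => rfl, fun _ _ => by simp [formF_apply]⟩
  smul_mem' := fun c A hA => ⟨fun e => by simp [hA.1], fun f => by simp [hA.2.1],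
    fun x y => by rw [formF_smul, formF_smul, hA.2.2]⟩

theorem apply_eq_of_mem_symmBlock {A : Module.End ℝ (XX s l)} (hA : A ∈ symmBlock s l)
    (x : XX s l) : A x = ((A (0, x.2)).1, 0) := by
  have h : x = (x.1, 0) + (0, x.2) := by simp
  conv_lhs => rw [h, map_add, hA.1, zero_add]
  exact Prod.ext rfl (hA.2.1 _)

theorem eq_zero_of_formF {A : Module.End ℝ (XX s l)} (hA : A ∈ symmBlock s l)
    (h : ∀ i j, -s ≤ i → i ≤ l - s → -s ≤ j → j ≤ l - s →
      formF A (Row.vec _ _ i) (Row.vec _ _ j) = 0) : A = 0 := by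
  have h0 : formF A = 0 :=
    Row.linearMap_ext fun i h1 h2 => Row.linearMap_ext fun j h3 h4 => by
      rw [h i j h1 h2 h3 h4]; rfl
  refine LinearMap.ext fun x => ?_
  rw [apply_eq_of_mem_symmBlock hA, eq_zero_of_tau_right (e := (A (0, x.2)).1)
    (fun f => by rw [← formF_apply, h0]; rfl)]
  rfl

/-- The commutator with `δ`. -/
def adDelta (A : Module.End ℝ (XX s l)) : Module.End ℝ (XX s l) := A * deltaX s l - deltaX s l * A

theorem formF_adDelta_vec (A : Module.End ℝ (XX s l)) {i j : ℤ} (hi : i ≤ l - s) (hj : j ≤ l - s) :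
    formF (adDelta A) (Row.vec _ _ i) (Row.vec _ _ j) =
      formF A (Row.vec _ _ (i - 1)) (Row.vec _ _ j) +
        formF A (Row.vec _ _ i) (Row.vec _ _ (j - 1)) := by
  rw [adDelta, formF_commutator, Row.shift_vec hi, Row.shift_vec hj]

theorem adDelta_mem_symmBlock {A : Module.End ℝ (XX s l)} (hA : A ∈ symmBlock s l) :
    adDelta A ∈ symmBlock s l := by
  refine ⟨fun e => ?_, fun f => ?_, fun x y => ?_⟩
  · simp [adDelta, hA.1]
  · simp [adDelta, hA.2.1]
  · rw [adDelta, formF_commutator, formF_commutator, hA.2.2 x, hA.2.2 _ y, add_comm]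

/-- All iterated commutators with `δ` define forms vanishing on the vectors of positive degree. -/
def VanishesOnPos (A : Module.End ℝ (XX s l)) : Prop :=
  ∀ n : ℕ, ∀ i j : ℤ, 1 ≤ i → i ≤ l - s → 1 ≤ j → j ≤ l - s →
    formF (adDelta^[n] A) (Row.vec _ _ i) (Row.vec _ _ j) = 0

theorem VanishesOnPos.adDelta {A : Module.End ℝ (XX s l)} (hA : VanishesOnPos A) :
    VanishesOnPos (adDelta A) := fun n => hA (n + 1)

/-- Descending induction on `i + j`. The inductive hypothesis for `[A, δ]`, whose entries are sums
of two adjacent entries of `A`, makes the form of `A` alternate in sign along the antidiagonal `i +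
j = N`. One zero on the antidiagonal is then enough. -/
theorem formF_eq_zero_of_vanishesOnPos (hsl : s < l) (m : ℕ) {A : Module.End ℝ (XX s l)}
    (hA : A ∈ symmBlock s l) (hv : VanishesOnPos A) {i j : ℤ} (hi : i ≤ l - s) (hj : j ≤ l - s)
    (hij : 1 ≤ i + j) (hm : i + j = 2 * (l - s) + 1 - m) :
    formF A (Row.vec _ _ i) (Row.vec _ _ j) = 0 := by
  induction m generalizing A i j with
  | zero => omega
  | succ m ih =>
    obtain ⟨N, hN⟩ : ∃ N, N = i + j := ⟨_, rfl⟩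
    set g : ℤ → ℝ := fun i => formF A (Row.vec _ _ i) (Row.vec _ _ (N - i)) with hg
    have hstep : ∀ i, i + 1 ≤ l - s → N - i ≤ l - s → g i = -g (i + 1) := by
      intro i h1 h2
      have e := ih (adDelta_mem_symmBlock hA) hv.adDelta h1 h2 (by omega) (by push_cast at hm; omega)
      rw [formF_adDelta_vec A h1 h2, add_sub_cancel_right] at e
      simp only [hg]
      rw [show N - (i + 1) = N - i - 1 by ring]
      linarith
    have hend : ∀ i, i ≤ l - s → N - i ≤ l - s → (g i = 0 ↔ g (l - s) = 0) := by
      intro i h1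
      induction i, h1 using Int.leInductionDown with
      | base => exact fun _ => Iff.rfl
      | pred n h1 ih' =>
        intro h2
        rw [hstep (n - 1) (by omega) h2, neg_eq_zero, sub_add_cancel]
        exact ih' (by omega)
    have hv0 : ∀ i, 1 ≤ i → i ≤ l - s → 1 ≤ N - i → N - i ≤ l - s → g i = 0 := fun i h1 h2 h3 h4 =>
      hv 0 i (N - i) h1 h2 h3 h4
    have hgl : g (l - s) = 0 := by
      -- For `N ≥ 2` the antidiagonal contains a pair of positive indices. For `N = 1` it does not,
      -- but the entries at `(0, 1)` and `(1, 0)` are both equal and opposite.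
      rcases (show N = 1 ∨ (2 ≤ N ∧ N ≤ l - s) ∨ l - s + 1 ≤ N by omega) with h | h | h
      · rw [← hend 0 (by omega) (by omega)]
        have e := hstep 0 (by omega) (by omega)
        have e' : g 0 = g (0 + 1) := by
          simp only [hg, h]
          exact hA.2.2 _ _
        linarith
      · rw [← hend (N - 1) (by omega) (by omega)]
        exact hv0 _ (by omega) (by omega) (by omega) (by omega)
      · exact hv0 _ (by omega) le_rfl (by omega) (by omega)
    have := (hend i hi (by omega)).mpr hgl
    simpa only [hg, hN, add_sub_cancel_left] using this

theorem VanishesOnPos.formF_eq_zero (hsl : s < l) {A : Module.End ℝ (XX s l)}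
    (hA : A ∈ symmBlock s l) (hv : VanishesOnPos A) {i j : ℤ} (hi : i ≤ l - s) (hj : j ≤ l - s)
    (hij : 1 ≤ i + j) : formF A (Row.vec _ _ i) (Row.vec _ _ j) = 0 :=
  formF_eq_zero_of_vanishesOnPos hsl (2 * (l - s) + 1 - (i + j)).toNat hA hv hi hj hij (by omega)

theorem mem_csp_of_mem_symmBlock {A : Module.End ℝ (XX s l)} (hA : A ∈ symmBlock s l) :
    A ∈ csp (sigmaX s l) := by
  refine ⟨0, fun v w => ?_⟩
  rw [sigmaX_apply, sigmaX_apply, apply_eq_of_mem_symmBlock hA v, apply_eq_of_mem_symmBlock hA w]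
  have := hA.2.2 v.2 w.2
  rw [formF_apply, formF_apply] at this
  simp only [map_zero]
  linarith

theorem formF_vec_of_mem_endDegree {k : ℤ} {A : Module.End ℝ (XX s l)}
    (hA : A ∈ endDegree (gradingX s l) k) {i j : ℤ} (hij : i + j ≠ -k) :
    formF A (Row.vec _ _ i) (Row.vec _ _ j) = 0 := by
  have hi := (hA i (0, Row.vec (-s) (l - s) i) ⟨Submodule.zero_mem _, Row.vec_mem_gr i⟩).1
  rw [formF_apply]
  refine tau_eq_zero_of_coeff fun m _ _ => ?_
  by_cases hm : m = i + k
  · exact Or.inr (Row.coeff_vec_of_ne (by omega))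
  · exact Or.inl (Row.mem_gr.mp hi m hm)

theorem adDelta_mem_endDegree {k : ℤ} {A : Module.End ℝ (XX s l)}
    (hA : A ∈ endDegree (gradingX s l) k) : adDelta A ∈ endDegree (gradingX s l) (k - 1) := by
  have hδ : ∀ i, ∀ x ∈ gradingX s l i, deltaX s l x ∈ gradingX s l (i - 1) := fun i x hx =>
    ⟨Row.shift_mem_gr hx.1, Row.shift_mem_gr hx.2⟩
  intro i x hx
  refine Submodule.sub_mem _ ?_ ?_
  · have := hA _ _ (hδ i x hx)
    rwa [show i - 1 + k = i + (k - 1) by ring] at this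
  · have := hδ _ _ (hA i x hx)
    rwa [add_sub_assoc] at this

theorem mem_uFComponent_of_vanishesOnPos (hsl : s < l) {k : ℕ} {A : Module.End ℝ (XX s l)}
    (hA : A ∈ symmBlock s l) (hv : VanishesOnPos A) (hd : A ∈ endDegree (gradingX s l) k) :
    A ∈ uFComponent (sigmaX s l) (gradingX s l) (deltaX s l) (k + 1) := by
  induction k generalizing A with
  | zero =>
    refine mem_uFComponent_succ.mpr ⟨⟨mem_csp_of_mem_symmBlock hA, hd⟩, ?_⟩
    have : adDelta A = 0 := by
      refine eq_zero_of_formF (adDelta_mem_symmBlock hA) fun i j _ h2 _ h4 => ?_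
      by_cases hij : 1 ≤ i + j
      -- In degree 0 the commutator vanishes altogether: the form of `[A, δ]` is zero for `i + j ≥
      -- 1` by the previous lemma, and homogeneity leaves only `i + j = 1`.
      · exact hv.adDelta.formF_eq_zero hsl (adDelta_mem_symmBlock hA) h2 h4 hij
      · rw [formF_adDelta_vec A h2 h4, formF_vec_of_mem_endDegree hd (by push_cast; omega),
          formF_vec_of_mem_endDegree hd (by push_cast; omega), add_zero]
    rw [adDelta] at this
    rw [this]
    exact Submodule.zero_mem _
  | succ k ih =>
    refine mem_uFComponent_succ.mpr ⟨⟨mem_csp_of_mem_symmBlock hA, hd⟩, ?_⟩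
    refine ih (adDelta_mem_symmBlock hA) hv.adDelta ?_
    have := adDelta_mem_endDegree hd
    rwa [show ((k + 1 : ℕ) : ℤ) - 1 = k by push_cast; ring] at this

/-- The component of degree `k` of the block `F → E` of an endomorphism. -/
def degreeComponent (k : ℤ) (A : Module.End ℝ (XX s l)) : Module.End ℝ (XX s l) :=
  LinearMap.inl ℝ _ _ ∘ₗ (LinearMap.pi fun m : ↥(Finset.Icc (s - l) s) =>
    (Row.coeff (s - l) s m (A (0, Row.vec _ _ (m - k))).1) • Row.coeff (-s) (l - s) (m - k)) ∘ₗ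
      LinearMap.snd ℝ _ _

theorem coeff_degreeComponent (k : ℤ) (A : Module.End ℝ (XX s l)) (x : XX s l) (m : ℤ) :
    Row.coeff (s - l) s m (degreeComponent k A x).1 =
      Row.coeff (s - l) s m (A (0, Row.vec _ _ (m - k))).1 * Row.coeff (-s) (l - s) (m - k) x.2 := by
  by_cases hm : m ∈ Finset.Icc (s - l) s
  · rw [Row.coeff_of_mem hm, Row.coeff_of_mem hm]
    simp [degreeComponent]
  · rw [Row.coeff_of_notMem hm, Row.coeff_of_notMem hm, zero_mul]

theorem formF_degreeComponent (k : ℤ) (A : Module.End ℝ (XX s l)) (i j : ℤ) :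
    formF (degreeComponent k A) (Row.vec _ _ i) (Row.vec _ _ j) =
      if i + j = -k then formF A (Row.vec _ _ i) (Row.vec _ _ j) else 0 := by
  by_cases hj : -s ≤ j ∧ j ≤ l - s
  · rw [formF_apply, formF_apply, tau_vec_right hj.1 hj.2, tau_vec_right hj.1 hj.2,
      coeff_degreeComponent, Row.coeff_vec]
    by_cases hij : i + j = -k
    · rw [if_pos hij, show -j - k = i by omega]
      by_cases hi : -s ≤ i ∧ i ≤ l - s
      · rw [if_pos ⟨rfl, hi⟩, mul_one]
      · have : Row.vec (-s) (l - s) i = 0 := by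
          rcases not_and_or.mp hi with h | h
          · exact Row.vec_eq_zero_of_lt (by omega)
          · exact Row.vec_eq_zero_of_gt (by omega)
        rw [this, Prod.mk_zero_zero, map_zero]
        simp
    · rw [if_neg hij, if_neg (by omega), mul_zero, mul_zero]
  · have : Row.vec (-s) (l - s) j = 0 := by
      rcases not_and_or.mp hj with h | h
      · exact Row.vec_eq_zero_of_lt (by omega)
      · exact Row.vec_eq_zero_of_gt (by omega)
    rw [this]
    simp

theorem degreeComponent_mem_symmBlock (k : ℤ) {A : Module.End ℝ (XX s l)} (hA : A ∈ symmBlock s l) :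
    degreeComponent k A ∈ symmBlock s l := by
  refine ⟨fun e => by simp [degreeComponent], fun f => by simp [degreeComponent], ?_⟩
  have : formF (degreeComponent k A) = (formF (degreeComponent k A)).flip := by
    refine Row.linearMap_ext fun i _ _ => Row.linearMap_ext fun j _ _ => ?_
    rw [LinearMap.flip_apply, formF_degreeComponent, formF_degreeComponent, add_comm j, hA.2.2]
  exact fun x y => LinearMap.congr_fun (LinearMap.congr_fun this x) y

theorem degreeComponent_mem_endDegree (k : ℤ) (A : Module.End ℝ (XX s l)) :
    degreeComponent k A ∈ endDegree (gradingX s l) k := by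
  intro i x hx
  refine ⟨Row.mem_gr.mpr fun j hj => ?_, ?_⟩
  · rw [coeff_degreeComponent, Row.mem_gr.mp hx.2 _ (by omega), mul_zero]
  · simp [degreeComponent]

theorem formF_iterate_degreeComponent (k : ℤ) (A : Module.End ℝ (XX s l)) (n : ℕ) {i j : ℤ}
    (hi : i ≤ l - s) (hj : j ≤ l - s) :
    formF (adDelta^[n] (degreeComponent k A)) (Row.vec _ _ i) (Row.vec _ _ j) =
      if i + j = n - k then formF (adDelta^[n] A) (Row.vec _ _ i) (Row.vec _ _ j) else 0 := by
  induction n generalizing i j with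
  | zero => simp [formF_degreeComponent]
  | succ n ih =>
    rw [Function.iterate_succ_apply', Function.iterate_succ_apply', formF_adDelta_vec _ hi hj,
      formF_adDelta_vec _ hi hj, ih (by omega) hj, ih hi (by omega)]
    by_cases h : i + j = (n + 1 : ℕ) - k
    · rw [if_pos h, if_pos (by push_cast at h; omega), if_pos (by push_cast at h; omega)]
    · rw [if_neg h, if_neg (by push_cast at h; omega), if_neg (by push_cast at h; omega), add_zero]

theorem VanishesOnPos.degreeComponent (k : ℤ) {A : Module.End ℝ (XX s l)} (hA : VanishesOnPos A) :
    VanishesOnPos (degreeComponent k A) := by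
  intro n i j h1 h2 h3 h4
  rw [formF_iterate_degreeComponent k A n h2 h4, hA n i j h1 h2 h3 h4, ite_self]

/-- Vanishing for `i + j ≥ 1` says that `A` has no components of negative degree, and each remaining
component inherits the hypothesis. Indices in `F` are at least `-s`, so degrees stop at `2s`. -/
theorem VanishesOnPos.mem_uF (hsl : s < l) (hls : l < 2 * s) {A : Module.End ℝ (XX s l)}
    (hA : A ∈ symmBlock s l) (hv : VanishesOnPos A) :
    A ∈ uF (sigmaX s l) (gradingX s l) (deltaX s l) := by
  have hsum : A = ∑ k ∈ Finset.range (2 * s + 1).toNat, FlagProlongation.degreeComponent (k : ℤ) A := by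
    rw [← sub_eq_zero]
    refine eq_zero_of_formF (Submodule.sub_mem _ hA
      (Submodule.sum_mem _ fun k _ => degreeComponent_mem_symmBlock k hA)) fun i j h1 h2 h3 h4 => ?_
    rw [formF_sub, formF_sum]
    simp only [formF_degreeComponent]
    by_cases hij : 1 ≤ i + j
    · simp [hv.formF_eq_zero hsl hA h2 h4 hij]
    · rw [Finset.sum_eq_single (-(i + j)).toNat]
      · rw [if_pos (by omega), sub_self]
      · intro k _ hk
        rw [if_neg (by omega)]
      · intro h
        exact absurd (Finset.mem_range.mpr (by omega)) h
  rw [hsum]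
  refine Submodule.sum_mem _ fun k _ => Submodule.mem_iSup_of_mem (k + 1) ?_
  exact mem_uFComponent_of_vanishesOnPos hsl (degreeComponent_mem_symmBlock k hA)
    (hv.degreeComponent k) (degreeComponent_mem_endDegree k A)

/-- Differentiating the identity in `t` repeatedly replaces `A` by its iterated commutators; then
set `t = 0`. -/
theorem vanishesOnPos_of_formF_expShift {A : Module.End ℝ (XX s l)}
    (h : ∀ t, ∀ x ∈ Row.pos (-s) (l - s), ∀ y ∈ Row.pos (-s) (l - s),
      formF A (Row.expShift (-s) (l - s) t x) (Row.expShift (-s) (l - s) t y) = 0) :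
    VanishesOnPos A := by
  have key : ∀ n : ℕ, ∀ t, ∀ x ∈ Row.pos (-s) (l - s), ∀ y ∈ Row.pos (-s) (l - s),
      formF (adDelta^[n] A) (Row.expShift (-s) (l - s) t x) (Row.expShift (-s) (l - s) t y) = 0 := by
    intro n
    induction n with
    | zero => exact h
    | succ n ih =>
      intro t x hx y hy
      rw [Function.iterate_succ_apply', adDelta]
      have e := hasDerivAt_formF (adDelta^[n] A) x y t
      simp only [ih _ x hx y hy] at e
      exact e.unique (hasDerivAt_const t 0)
  intro n i j h1 h2 h3 h4
  simpa using key n 0 _ (Row.vec_mem_pos h1 h2) _ (Row.vec_mem_pos h3 h4)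

theorem mem_uF_of_formF_expShift (hsl : s < l) (hls : l < 2 * s) {A : Module.End ℝ (XX s l)}
    (hA : A ∈ symmBlock s l)
    (h : ∀ t, ∀ x ∈ Row.pos (-s) (l - s), ∀ y ∈ Row.pos (-s) (l - s),
      formF A (Row.expShift (-s) (l - s) t x) (Row.expShift (-s) (l - s) t y) = 0) :
    A ∈ uF (sigmaX s l) (gradingX s l) (deltaX s l) :=
  (vanishesOnPos_of_formF_expShift h).mem_uF hsl hls hA

end

/-! ### The first prolongation. -/

section

variable {s l : ℤ}

theorem Row.exists_ne_zero_of_functional {a b : ℤ} (hab : a < b) (f : Row a b →ₗ[ℝ] ℝ) :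
    ∃ x, x ≠ 0 ∧ f x = 0 := by
  have hne : ∀ i, a ≤ i → i ≤ b → Row.vec a b i ≠ 0 := fun i h1 h2 h => by
    have := Row.coeff_vec_self h1 h2
    rw [h, map_zero] at this
    exact zero_ne_one this
  by_cases h : f (Row.vec a b b) = 0
  · exact ⟨_, hne b hab.le le_rfl, h⟩
  · refine ⟨f (Row.vec a b a) • Row.vec a b b - f (Row.vec a b b) • Row.vec a b a, fun h0 => ?_, ?_⟩
    · have := congrArg (Row.coeff a b a) h0
      rw [map_sub, map_smul, map_smul, Row.coeff_vec_of_ne hab.ne, Row.coeff_vec_self le_rfl hab.le,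
        map_zero] at this
      simp [h] at this
    · simp only [map_sub, map_smul, smul_eq_mul]
      ring

theorem exists_tau_right_ne_zero (hsl : 0 < l) (e : E s l) : ∃ f, f ≠ 0 ∧ tau s l e f = 0 :=
  Row.exists_ne_zero_of_functional (by omega) (tau s l e)

theorem exists_tau_eq_one (hsl : 0 < l) (f : F s l) : ∃ e f', tau s l e f = 0 ∧ tau s l e f' = 1 := by
  obtain ⟨e, he, hef⟩ := Row.exists_ne_zero_of_functional (a := s - l) (b := s) (by omega)
    ((tau s l).flip f)
  have : ∃ f', tau s l e f' ≠ 0 := by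
    by_contra! h
    exact he (eq_zero_of_tau_right h)
  obtain ⟨f', hf'⟩ := this
  exact ⟨e, (tau s l e f')⁻¹ • f', hef, by rw [map_smul, smul_eq_mul, inv_mul_cancel₀ hf']⟩

/-- The rational normal curve lies in no hyperplane: its derivatives at `0` are all the basis
vectors. -/
theorem Row.functional_eq_zero_of_expShift {a b : ℤ} (f : Row a b →ₗ[ℝ] ℝ)
    (h : ∀ t, f (Row.expShift a b t (Row.vec a b b)) = 0) : f = 0 := by
  have key : ∀ n : ℕ, ∀ t, f (Row.expShift a b t ((Row.shift a b ^ n) (Row.vec a b b))) = 0 := by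
    intro n
    induction n with
    | zero => simpa using h
    | succ n ih =>
      intro t
      have e := (LinearMap.toContinuousLinearMap f).hasFDerivAt.comp_hasDerivAt t
        (Row.hasDerivAt_expShift ((Row.shift a b ^ n) (Row.vec a b b)) t)
      have hf : (LinearMap.toContinuousLinearMap f ∘ fun t => Row.expShift a b t
          ((Row.shift a b ^ n) (Row.vec a b b))) = fun _ => 0 := funext ih
      rw [hf] at e
      rw [pow_succ', Module.End.mul_apply]
      exact e.unique (hasDerivAt_const t 0)
  refine Row.linearMap_ext fun i h1 h2 => ?_
  have := key (b - i).toNat 0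
  rw [Row.expShift_zero, Row.shift_pow_vec _ le_rfl, show b - ((b - i).toNat : ℤ) = i by omega] at this
  exact this

/-- The first prolongation of `uF` contains only elements that annihilate `E` and the centre. -/
theorem first_prolongation (hsl : s < l) (hls : l < 2 * s)
    (T : XX s l →ₗ[ℝ] Module.End ℝ (XX s l)) (c : XX s l →ₗ[ℝ] ℝ) (ξ : XX s l)
    (hT : ∀ v, T v ∈ uF (sigmaX s l) (gradingX s l) (deltaX s l))
    (hc : ∀ v x y, c v * sigmaX s l x y = sigmaX s l (T v x) y - sigmaX s l (T v y) x)
    (hξ : ∀ v w, T v w - T w v = sigmaX s l v w • ξ) :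
    ξ = 0 ∧ c = 0 ∧ (∀ e, T (e, 0) = 0) ∧ (∀ v e, T v (e, 0) = 0) ∧ ∀ v w, (T v w).2 = 0 := by
  have hblocks := fun v => uF_blocks hsl hls (hT v)
  -- Both `E` and `F` are isotropic, so `T` is symmetric on each and its diagonal block there is a
  -- first prolongation of `𝔤𝔩₂`.
  have hEE : ∀ e e', (T (e, 0) (e', 0)).1 = 0 := by
    have := Row.gl2_prolongation_eq_zero (a := s - l) (b := s) (by omega)
      ((T.compl₁₂ (LinearMap.inl ℝ _ _) (LinearMap.inl ℝ _ _)).compr₂ (LinearMap.fst ℝ _ _))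
      (fun x => (hblocks (x, 0)).2.1) (fun x y => by
        have := congrArg Prod.fst (hξ (x, 0) (y, 0))
        simpa [sigmaX_apply, sub_eq_zero] using this)
    exact fun e e' => LinearMap.congr_fun (LinearMap.congr_fun this e) e'
  have hFF : ∀ f f', (T (0, f) (0, f')).2 = 0 := by
    have := Row.gl2_prolongation_eq_zero (a := -s) (b := l - s) (by omega)
      ((T.compl₁₂ (LinearMap.inr ℝ _ _) (LinearMap.inr ℝ _ _)).compr₂ (LinearMap.snd ℝ _ _))
      (fun x => (hblocks (0, x)).2.2) (fun x y => by
        have := congrArg Prod.snd (hξ (0, x) (0, y))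
        simpa [sigmaX_apply, sub_eq_zero] using this)
    exact fun e e' => LinearMap.congr_fun (LinearMap.congr_fun this e) e'
  have hpair : ∀ v e f, c v * tau s l e f =
      tau s l (T v (e, 0)).1 f + tau s l e (T v (0, f)).2 := fun v e f => by
    simpa [sigmaX_apply] using hc v (e, 0) (0, f)
  have hEF : ∀ e f, (T (e, 0) (0, f)).2 = c (e, 0) • f := fun e f => by
    rw [← sub_eq_zero]
    refine eq_zero_of_tau_left fun e' => ?_
    have := hpair (e, 0) e' f
    rw [hEE, map_zero, LinearMap.zero_apply, zero_add] at this
    rw [map_sub, map_smul, smul_eq_mul, this, sub_self]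
  have hFE : ∀ e f, (T (0, f) (e, 0)).1 = c (0, f) • e := fun e f => by
    rw [← sub_eq_zero]
    refine eq_zero_of_tau_right fun f' => ?_
    have := hpair (0, f) e f'
    rw [hFF, map_zero, add_zero] at this
    rw [map_sub, map_smul, LinearMap.sub_apply, LinearMap.smul_apply, smul_eq_mul, this, sub_self]
  have hmix : ∀ e f, T (e, 0) (0, f) - T (0, f) (e, 0) = tau s l e f • ξ := fun e f => by
    simpa [sigmaX_apply] using hξ (e, 0) (0, f)
  -- `T (0, f)` preserves `E`, so only the first term contributes an `F` component. Taking `f`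
  -- orthogonal to `e` gives `c = 0` on `E`, and then `τ(e, f) = 1` gives `ξ.2 = 0`.
  have hmix2 : ∀ e f, c (e, 0) • f = tau s l e f • ξ.2 := fun e f => by
    have := congrArg Prod.snd (hmix e f)
    rwa [Prod.snd_sub, hEF, (hblocks _).1, sub_zero] at this
  have hmix1 : ∀ e f, (T (e, 0) (0, f)).1 = c (0, f) • e + tau s l e f • ξ.1 := fun e f => by
    have := congrArg Prod.fst (hmix e f)
    rw [Prod.fst_sub, hFE] at this
    rw [← sub_eq_iff_eq_add']
    exact this
  have hcE : ∀ e, c (e, 0) = 0 := fun e => by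
    obtain ⟨f, hf, hef⟩ := exists_tau_right_ne_zero (by omega) e
    have := hmix2 e f
    rw [hef, zero_smul] at this
    exact (smul_eq_zero.mp this).resolve_right hf
  have hξ2 : ξ.2 = 0 := by
    obtain ⟨e, f, -, hef⟩ := exists_tau_eq_one (s := s) (l := l) (by omega) 0
    have := hmix2 e f
    rw [hef, one_smul, hcE, zero_smul] at this
    exact this.symm
  have hform : ∀ e f f', formF (T (e, 0)) f f' =
      c (0, f) * tau s l e f' + tau s l e f * tau s l ξ.1 f' := fun e f f' => by
    rw [formF_apply, hmix1]
    simp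
  have hsymm : ∀ e f f', formF (T (e, 0)) f f' = formF (T (e, 0)) f' f := fun e f f' => by
    have := hc (e, 0) (0, f) (0, f')
    simpa [sigmaX_apply, formF_apply, sub_eq_zero] using this.symm
  have hcF : ∀ f, c (0, f) = tau s l ξ.1 f := fun f => by
    obtain ⟨e, f', h0, h1⟩ := exists_tau_eq_one (by omega) f
    have := hsymm e f f'
    rw [hform, hform, h0, h1] at this
    linarith
  -- The quadratic form of `T (e, 0)` is now `2 τ(e, f) τ(ξ.1, f)`. It vanishes on the curve for
  -- every `e`, so the hyperplane defined by `ξ.1` would contain the curve.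
  have hξ1 : ξ.1 = 0 := by
    have h0 : tau s l ξ.1 = 0 := by
      refine Row.functional_eq_zero_of_expShift _ fun t => ?_
      by_contra hne
      have hp : Row.vec (-s) (l - s) (l - s) ∈ Row.pos (-s) (l - s) :=
        Row.vec_mem_pos (by omega) le_rfl
      have : Row.expShift (-s) (l - s) t (Row.vec (-s) (l - s) (l - s)) = 0 := by
        refine eq_zero_of_tau_left fun e => ?_
        have h := formF_expShift_eq_zero_of_mem_uF (hT (e, 0)) t hp hp
        rw [hform, hcF, mul_comm (tau s l e _), ← two_mul] at h
        simpa [hne] using h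
      rw [this, map_zero] at hne
      exact hne rfl
    exact eq_zero_of_tau_right fun f => by rw [h0]; rfl
  have hcF0 : ∀ f, c (0, f) = 0 := fun f => by rw [hcF, hξ1]; simp
  have hsplit : ∀ v : XX s l, v = (v.1, 0) + (0, v.2) := fun v => by simp
  have hTE : ∀ e, T (e, 0) = 0 := fun e => by
    refine LinearMap.ext fun v => ?_
    rw [hsplit v, map_add]
    have h1 : T (e, 0) (v.1, 0) = 0 := Prod.ext (hEE _ _) ((hblocks _).1 _)
    have h2 : T (e, 0) (0, v.2) = 0 := by
      refine Prod.ext ?_ ?_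
      · rw [hmix1, hcF0, hξ1]; simp
      · rw [hEF, hcE]; simp
    rw [h1, h2, add_zero, LinearMap.zero_apply]
  have hTvE : ∀ v e, T v (e, 0) = 0 := fun v e => by
    rw [hsplit v, map_add, LinearMap.add_apply, hTE, LinearMap.zero_apply, zero_add]
    exact Prod.ext (by rw [hFE, hcF0]; simp) ((hblocks _).1 _)
  refine ⟨Prod.ext hξ1 hξ2, ?_, hTE, hTvE, fun v w => ?_⟩
  · refine LinearMap.ext fun v => ?_
    rw [hsplit v, map_add, hcE, hcF0, add_zero, LinearMap.zero_apply]
  · rw [hsplit w, map_add, hTvE, zero_add, hsplit v, map_add, LinearMap.add_apply, hTE,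
      LinearMap.zero_apply, zero_add, hFF]

end

/-! ### Higher Tanaka prolongations are symmetric prolongations on `F`. -/

section

variable {s l : ℤ}

/-- The element of nonnegative degree with restriction `A` to `η⁻¹` and zero restriction to `η⁻²`. -/
def Amb.ofX {X : Type} [AddCommGroup X] [Module ℝ X] (n : ℕ) (A : X →ₗ[ℝ] Amb X (n + 1)) :
    Amb X (n + 2) :=
  ((A, 0) : (X →ₗ[ℝ] Amb X (n + 1)) × (ℝ →ₗ[ℝ] Amb X n))

@[simp]
theorem Amb.onX_ofX {X : Type} [AddCommGroup X] [Module ℝ X] (n : ℕ) (A : X →ₗ[ℝ] Amb X (n + 1)) :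
    Amb.onX n (Amb.ofX n A) = A := rfl

@[simp]
theorem Amb.onZ_ofX {X : Type} [AddCommGroup X] [Module ℝ X] (n : ℕ) (A : X →ₗ[ℝ] Amb X (n + 1)) :
    Amb.onZ n (Amb.ofX n A) = 0 := rfl

theorem Amb.eq_zero {X : Type} [AddCommGroup X] [Module ℝ X] {n : ℕ} {φ : Amb X (n + 2)}
    (h₁ : ∀ v, Amb.onX n φ v = 0) (h₂ : Amb.onZ n φ = 0) : φ = 0 :=
  Prod.ext (LinearMap.ext h₁) h₂

/-- The condition that an element of degree `0` acts on `η⁻¹` by an element of `g0`. -/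
def degreeZeroCondition (g0 : Submodule ℝ (Module.End ℝ (XX s l))) :
    (n : ℕ) → Submodule ℝ (Amb (XX s l) (n + 2))
  | 0 => Submodule.comap (Amb.onX 0) g0
  | _ + 1 => ⊤

/-- `symmProlongation g0 n` is the space of the elements of degree `n - 1` that annihilate `E` and
`η⁻²` and are symmetric on `F`, with values in `E` and with the component of degree zero in `g0`. -/
def symmProlongation (g0 : Submodule ℝ (Module.End ℝ (XX s l))) :
    (n : ℕ) → Submodule ℝ (Amb (XX s l) (n + 1))
  | 0 => LinearMap.ker (LinearMap.snd ℝ (E s l) (F s l))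
  | n + 1 =>
    { carrier := {φ | φ ∈ degreeZeroCondition g0 n ∧ Amb.onZ n φ = 0 ∧ IsDerXX (sigmaX s l) n φ ∧
        (∀ e, Amb.onX n φ (e, 0) = 0) ∧ ∀ v, Amb.onX n φ v ∈ symmProlongation g0 n}
      add_mem' := fun hf hg => ⟨Submodule.add_mem _ hf.1 hg.1,
        by rw [map_add, hf.2.1, hg.2.1, add_zero], hf.2.2.1.add hg.2.2.1,
        fun e => by rw [map_add, LinearMap.add_apply, hf.2.2.2.1, hg.2.2.2.1, add_zero],
        fun v => by
          rw [map_add, LinearMap.add_apply]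
          exact Submodule.add_mem _ (hf.2.2.2.2 v) (hg.2.2.2.2 v)⟩
      zero_mem' := ⟨Submodule.zero_mem _, map_zero _, IsDerXX.zero _ _,
        fun e => by rw [map_zero, LinearMap.zero_apply],
        fun v => by
          rw [map_zero, LinearMap.zero_apply]
          exact Submodule.zero_mem _⟩
      smul_mem' := fun c _ hf => ⟨Submodule.smul_mem _ c hf.1,
        by rw [map_smul, hf.2.1, smul_zero], hf.2.2.1.smul c,
        fun e => by rw [map_smul, LinearMap.smul_apply, hf.2.2.2.1, smul_zero],
        fun v => by
          rw [map_smul, LinearMap.smul_apply]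
          exact Submodule.smul_mem _ c (hf.2.2.2.2 v)⟩ }

variable {g0 : Submodule ℝ (Module.End ℝ (XX s l))}

theorem mem_symmProlongation_succ {n : ℕ} {φ : Amb (XX s l) (n + 2)} :
    φ ∈ symmProlongation g0 (n + 1) ↔ φ ∈ degreeZeroCondition g0 n ∧ Amb.onZ n φ = 0 ∧
      IsDerXX (sigmaX s l) n φ ∧ (∀ e, Amb.onX n φ (e, 0) = 0) ∧
        ∀ v, Amb.onX n φ v ∈ symmProlongation g0 n := Iff.rfl

theorem bracket_comm_of_mem {n : ℕ} {φ : Amb (XX s l) (n + 2)}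
    (hφ : φ ∈ symmProlongation g0 (n + 1)) (v w : XX s l) :
    Amb.bracket (sigmaX s l) n (Amb.onX n φ v) w = Amb.bracket (sigmaX s l) n (Amb.onX n φ w) v := by
  have := (mem_symmProlongation_succ.mp hφ).2.2.1 v w
  rw [(mem_symmProlongation_succ.mp hφ).2.1, LinearMap.zero_apply] at this
  exact (sub_eq_zero.mp this.symm)

theorem onX_comm_of_mem {n : ℕ} {φ : Amb (XX s l) (n + 3)}
    (hφ : φ ∈ symmProlongation g0 (n + 2)) (v w : XX s l) :
    Amb.onX n (Amb.onX (n + 1) φ v) w = Amb.onX n (Amb.onX (n + 1) φ w) v :=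
  bracket_comm_of_mem hφ v w

theorem onX_snd_of_mem {n : ℕ} {φ : Amb (XX s l) (n + 2)}
    (hφ : φ ∈ symmProlongation g0 (n + 1)) (v : XX s l) :
    Amb.onX n φ v = Amb.onX n φ (0, v.2) := by
  have h : v = (v.1, 0) + (0, v.2) := by simp
  conv_lhs => rw [h, map_add, (mem_symmProlongation_succ.mp hφ).2.2.2.1, zero_add]

theorem eq_zero_of_mem_of_onX {n : ℕ} {φ : Amb (XX s l) (n + 2)}
    (hφ : φ ∈ symmProlongation g0 (n + 1)) (h : ∀ f, Amb.onX n φ (0, f) = 0) : φ = 0 :=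
  Amb.eq_zero (fun v => by rw [onX_snd_of_mem hφ, h]) (mem_symmProlongation_succ.mp hφ).2.1

theorem symmProlongation_le_tanakaAux (n : ℕ) :
    symmProlongation g0 (n + 1) ≤ tanakaAux (sigmaX s l) g0 (n + 2) := by
  induction n with
  | zero => exact fun φ hφ => ⟨hφ.1, hφ.2.2.1⟩
  | succ n ih =>
    intro φ hφ
    obtain ⟨-, hZ, hD, -, hS⟩ := mem_symmProlongation_succ.mp hφ
    refine ⟨fun v => ih (hS v), fun z => ?_, hD, fun v z => ?_⟩
    · rw [hZ]
      exact Submodule.zero_mem _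
    · rw [hZ, (mem_symmProlongation_succ.mp (hS v)).2.1]
      simp

theorem tanakaAux_three_le (hsl : s < l) (hls : l < 2 * s) :
    tanakaAux (sigmaX s l) (uF (sigmaX s l) (gradingX s l) (deltaX s l)) 3 ≤
      symmProlongation (uF (sigmaX s l) (gradingX s l) (deltaX s l)) 2 := by
  intro φ hφ
  obtain ⟨hX, -, hD, -⟩ := hφ
  -- The scalar `c v` is the action of `φ(v)` on the generator of the centre, and `ξ` is the value
  -- of `φ` at that generator.
  obtain ⟨hξ, hc, hTE, hTvE, hT2⟩ := first_prolongation hsl hls (Amb.onX 0 ∘ₗ Amb.onX 1 φ)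
    (LinearMap.applyₗ (R := ℝ) (1 : ℝ) ∘ₗ Amb.onZ 0 ∘ₗ Amb.onX 1 φ) (Amb.onZ 1 φ (1 : ℝ))
    (fun v => (hX v).1) (fun v x y => by
      have h1 := (hX v).2 x y
      have h2 : Amb.onZ 0 (Amb.onX 1 φ v) (sigmaX s l x y) =
          sigmaX s l x y • Amb.onZ 0 (Amb.onX 1 φ v) (1 : ℝ) := by
        rw [← map_smul, smul_eq_mul, mul_one]
      rw [h2] at h1
      refine Eq.trans ?_ h1
      exact mul_comm _ _) (fun v w => by
      have h1 := hD v w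
      have h2 : Amb.onZ 1 φ (sigmaX s l v w) = sigmaX s l v w • Amb.onZ 1 φ (1 : ℝ) := by
        rw [← map_smul, smul_eq_mul, mul_one]
      exact (h1.symm.trans h2))
  have hZ0 : ∀ v, Amb.onZ 0 (Amb.onX 1 φ v) = 0 := fun v =>
    LinearMap.ext_ring (LinearMap.congr_fun hc v)
  refine mem_symmProlongation_succ.mpr ⟨trivial, LinearMap.ext_ring hξ, hD,
    fun e => Amb.eq_zero (LinearMap.congr_fun (hTE e)) (hZ0 _), fun v => ?_⟩
  exact mem_symmProlongation_succ.mpr ⟨(hX v).1, hZ0 v, (hX v).2, hTvE v, fun w => hT2 v w⟩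

/-- Put `Ψ = φ(1)` for the central generator. As `φ(f)` kills `E`, the derivation identity gives
`φ(e)(f) = τ(e, f) Ψ`. Given `f`, choose `e` and `f'` with `τ(e, f) = 0` and `τ(e, f') = 1`;
symmetry of `φ(e)` in `f, f'` yields `Ψ(f) = 0`. So `Ψ = 0`, and then `φ(e) = 0`. -/
theorem mem_symmProlongation_of_onX_mem (hl : 0 < l) {n : ℕ} {φ : Amb (XX s l) (n + 4)}
    (hD : IsDerXX (sigmaX s l) (n + 2) φ)
    (hS : ∀ v, Amb.onX (n + 2) φ v ∈ symmProlongation g0 (n + 2)) :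
    φ ∈ symmProlongation g0 (n + 3) := by
  set Ψ : Amb (XX s l) (n + 2) := Amb.onZ (n + 2) φ (1 : ℝ) with hΨ
  have hmix : ∀ e f, Amb.onX (n + 1) (Amb.onX (n + 2) φ (e, 0)) (0, f) = tau s l e f • Ψ := by
    intro e f
    have h1 := hD (e, 0) (0, f)
    have h2 : sigmaX s l (e, 0) (0, f) = tau s l e f • (1 : ℝ) := by simp [sigmaX_apply]
    rw [h2, map_smul] at h1
    have h3 : Amb.bracket (sigmaX s l) (n + 2) (Amb.onX (n + 2) φ (0, f)) (e, 0) = 0 :=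
      (mem_symmProlongation_succ.mp (hS (0, f))).2.2.2.1 e
    rw [h3, sub_zero] at h1
    exact h1.symm
  have hΨS : Ψ ∈ symmProlongation g0 (n + 1) := by
    obtain ⟨e, f, -, hef⟩ := exists_tau_eq_one (s := s) (l := l) hl 0
    have h := (mem_symmProlongation_succ.mp (hS (e, 0))).2.2.2.2 (0, f)
    rwa [hmix, hef, one_smul] at h
  have hΨ0 : Ψ = 0 := by
    refine eq_zero_of_mem_of_onX hΨS fun f => ?_
    obtain ⟨e, f', h0, h1⟩ := exists_tau_eq_one hl f
    have h := onX_comm_of_mem (hS (e, 0)) (0, f') (0, f)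
    rw [hmix, hmix, h0, h1, one_smul, zero_smul, map_zero, LinearMap.zero_apply] at h
    exact h
  refine mem_symmProlongation_succ.mpr ⟨trivial, LinearMap.ext_ring hΨ0, hD, fun e => ?_, hS⟩
  exact eq_zero_of_mem_of_onX (hS (e, 0)) fun f => by rw [hmix, hΨ0, smul_zero]

theorem tanakaAux_eq_symmProlongation (hsl : s < l) (hls : l < 2 * s) (n : ℕ) :
    tanakaAux (sigmaX s l) (uF (sigmaX s l) (gradingX s l) (deltaX s l)) (n + 3) =
      symmProlongation (uF (sigmaX s l) (gradingX s l) (deltaX s l)) (n + 2) := by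
  refine le_antisymm ?_ (symmProlongation_le_tanakaAux (n + 1))
  induction n with
  | zero => exact tanakaAux_three_le hsl hls
  | succ n ih =>
    intro φ hφ
    obtain ⟨hX, -, hD, -⟩ := hφ
    exact mem_symmProlongation_of_onX_mem (by omega) hD fun v => ih (hX v)

end

/-! ### Polynomials attached to prolongation elements. -/

section

open MvPolynomial in
theorem pderiv_comm {ι : Type*} (i j : ι) (p : MvPolynomial ι ℝ) :
    pderiv i (pderiv j p) = pderiv j (pderiv i p) := by
  have h : ⁅pderiv (R := ℝ) i, pderiv (R := ℝ) j⁆ = 0 := by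
    classical
    refine MvPolynomial.derivation_ext fun m => ?_
    rw [Derivation.commutator_apply, pderiv_X, pderiv_X]
    simp only [Pi.single_apply]
    split_ifs <;> simp
  have h' := Derivation.congr_fun h p
  rwa [Derivation.commutator_apply, Derivation.zero_apply, sub_eq_zero] at h'

theorem eval_smul_of_isHomogeneous {ι : Type*} [Fintype ι] {d : ℕ} {p : MvPolynomial ι ℝ}
    (hp : p.IsHomogeneous d) (a : ℝ) (v : ι → ℝ) :
    MvPolynomial.eval (a • v) p = a ^ d * MvPolynomial.eval v p := by
  rw [MvPolynomial.eval_eq', MvPolynomial.eval_eq', Finset.mul_sum]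
  refine Finset.sum_congr rfl fun m hm => ?_
  have hd : ∑ i, m i = d := by
    have := hp (MvPolynomial.mem_support_iff.mp hm)
    rwa [Finsupp.weight_apply, Finsupp.sum_fintype _ _ (by simp),
      Finset.sum_congr rfl fun i _ => by rw [Pi.one_apply, smul_eq_mul, mul_one]] at this
  simp only [Pi.smul_apply, smul_eq_mul, mul_pow, Finset.prod_mul_distrib,
    Finset.prod_pow_eq_pow_sum, hd]
  ring

theorem eval_zero_of_isHomogeneous {ι : Type*} [Fintype ι] {d : ℕ} {p : MvPolynomial ι ℝ}
    (hp : p.IsHomogeneous (d + 1)) : MvPolynomial.eval (0 : ι → ℝ) p = 0 := by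
  have := eval_smul_of_isHomogeneous hp 0 0
  rwa [zero_smul, zero_pow (by omega), zero_mul] at this

theorem hasDerivAt_eval_add_smul {ι : Type*} [Fintype ι] (p : MvPolynomial ι ℝ) (y x : ι → ℝ)
    (t : ℝ) : HasDerivAt (fun t : ℝ => MvPolynomial.eval (y + t • x) p)
      (∑ i, x i * MvPolynomial.eval (y + t • x) (MvPolynomial.pderiv i p)) t := by
  classical
  induction p using MvPolynomial.induction_on with
  | C a => simpa using hasDerivAt_const t a
  | add p q hp hq =>
    simp only [map_add, mul_add, Finset.sum_add_distrib]
    exact hp.add hq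
  | mul_X p j hp =>
    have hX : HasDerivAt (fun t : ℝ => y j + t * x j) (x j) t := by
      simpa using ((hasDerivAt_id t).mul_const (x j)).const_add (y j)
    simp only [map_mul, MvPolynomial.eval_X, Pi.add_apply, Pi.smul_apply, smul_eq_mul]
    refine (hp.mul hX).congr_deriv ?_
    simp only [MvPolynomial.pderiv_mul, MvPolynomial.pderiv_X, map_add, map_mul,
      MvPolynomial.eval_X, Pi.add_apply, Pi.smul_apply, smul_eq_mul, Pi.single_apply, mul_add,
      Finset.sum_add_distrib, Finset.sum_mul]
    congr 1
    · congr 1 <;> exact Finset.sum_congr rfl fun i _ => by ring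
    · rw [Finset.sum_eq_single j]
      · simp [mul_comm]
      · intro i _ hij
        simp [Ne.symm hij]
      · simp

variable {s l : ℤ}

/-- The coordinates of `F`. -/
abbrev Coord (s l : ℤ) : Type := ↥(Finset.Icc (-s) (l - s))

/-- The basis vectors of `F` in `X`. -/
def fVec (i : Coord s l) : XX s l := (0, Row.vec (-s) (l - s) i)

theorem sum_fVec (f : F s l) : ∑ i : Coord s l, f i • fVec i = ((0, f) : XX s l) := by
  have h := congrArg (LinearMap.inr ℝ (E s l) (F s l)) (Row.sum_vec f)
  rw [map_sum] at h
  refine Eq.trans (Finset.sum_congr rfl fun i _ => ?_) h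
  rw [map_smul]
  rfl

theorem sigmaX_swap (x y : XX s l) : sigmaX s l x y = -sigmaX s l y x := by
  rw [sigmaX_apply, sigmaX_apply]
  ring

/-- The linear form `v ↦ σ(v, x)` on `F`. -/
def linearPoly (s l : ℤ) : XX s l →ₗ[ℝ] MvPolynomial (Coord s l) ℝ :=
  ∑ i : Coord s l, (sigmaX s l (fVec i)).smulRight (MvPolynomial.X i)

theorem linearPoly_apply (x : XX s l) :
    linearPoly s l x = ∑ i : Coord s l, sigmaX s l (fVec i) x • MvPolynomial.X i := by
  simp [linearPoly, LinearMap.sum_apply]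

theorem pderiv_linearPoly (x : XX s l) (i : Coord s l) :
    MvPolynomial.pderiv i (linearPoly s l x) = MvPolynomial.C (sigmaX s l (fVec i) x) := by
  classical
  rw [linearPoly_apply, map_sum, Finset.sum_eq_single i]
  · rw [Derivation.map_smul, MvPolynomial.pderiv_X_self, MvPolynomial.smul_eq_C_mul, mul_one]
  · intro j _ hj
    rw [Derivation.map_smul, MvPolynomial.pderiv_X_of_ne hj, smul_zero]
  · simp

theorem sum_X_mul_pderiv_linearPoly (A : XX s l → XX s l)
    (hA : ∀ i j, sigmaX s l (A (fVec i)) (fVec j) = sigmaX s l (A (fVec j)) (fVec i))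
    (i : Coord s l) :
    ∑ j, MvPolynomial.X j * MvPolynomial.pderiv i (linearPoly s l (A (fVec j))) =
      linearPoly s l (A (fVec i)) := by
  rw [linearPoly_apply]
  refine Finset.sum_congr rfl fun j _ => ?_
  rw [pderiv_linearPoly, mul_comm, ← MvPolynomial.smul_eq_C_mul, sigmaX_swap, hA j i,
    ← sigmaX_swap]

theorem isHomogeneous_linearPoly (x : XX s l) : (linearPoly s l x).IsHomogeneous 1 := by
  rw [linearPoly_apply]
  refine MvPolynomial.IsHomogeneous.sum _ _ _ fun i _ => ?_
  rw [MvPolynomial.smul_eq_C_mul]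
  exact (MvPolynomial.isHomogeneous_X ℝ i).C_mul _

theorem eq_zero_of_linearPoly_eq_zero {x : XX s l} (hx : x.2 = 0) (h : linearPoly s l x = 0) :
    x = 0 := by
  refine Prod.ext (eq_zero_of_tau_right fun f => ?_) hx
  have h0 : tau s l x.1 = 0 := by
    refine Row.linearMap_ext fun i h1 h2 => ?_
    have e := pderiv_linearPoly x ⟨i, Finset.mem_Icc.mpr ⟨h1, h2⟩⟩
    rw [h, map_zero] at e
    have e' := MvPolynomial.C_injective _ _ (e.symm.trans MvPolynomial.C_0.symm)
    rw [sigmaX_apply] at e'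
    simpa [fVec] using e'
  rw [h0]
  rfl

theorem eval_linearPoly {x : XX s l} (hx : x.2 = 0) (v : XX s l) :
    MvPolynomial.eval v.2 (linearPoly s l x) = sigmaX s l v x := by
  have h1 : MvPolynomial.eval v.2 (linearPoly s l x) = sigmaX s l (0, v.2) x := by
    rw [linearPoly_apply, ← sum_fVec, map_sum, map_sum, LinearMap.sum_apply]
    refine Finset.sum_congr rfl fun i _ => ?_
    simp [MvPolynomial.smul_eval, mul_comm]
  rw [h1, sigmaX_apply, sigmaX_apply, hx]
  simp

/-- The polynomial `v ↦ σ(v, [… [[φ, v], v], …, v])` on `F`. -/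
def toPoly (s l : ℤ) : (n : ℕ) → Amb (XX s l) (n + 1) →ₗ[ℝ] MvPolynomial (Coord s l) ℝ
  | 0 => linearPoly s l
  | n + 1 => ∑ i : Coord s l,
      LinearMap.mulLeft ℝ (MvPolynomial.X i) ∘ₗ toPoly s l n ∘ₗ (Amb.onX n).flip (fVec i)

theorem toPoly_succ (n : ℕ) (φ : Amb (XX s l) (n + 2)) :
    toPoly s l (n + 1) φ = ∑ i : Coord s l,
      MvPolynomial.X i * toPoly s l n (Amb.onX n φ (fVec i)) :=
  LinearMap.sum_apply ..

theorem isHomogeneous_toPoly (n : ℕ) (φ : Amb (XX s l) (n + 1)) :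
    (toPoly s l n φ).IsHomogeneous (n + 1) := by
  induction n with
  | zero => exact isHomogeneous_linearPoly φ
  | succ n ih =>
    rw [toPoly_succ]
    refine MvPolynomial.IsHomogeneous.sum _ _ _ fun i _ => ?_
    have := (MvPolynomial.isHomogeneous_X ℝ i).mul (ih (Amb.onX n φ (fVec i)))
    rwa [add_comm 1] at this

variable {g0 : Submodule ℝ (Module.End ℝ (XX s l))}

/-- The polynomial is a symmetric tensor with `n + 2` slots restricted to the diagonal; by symmetry
each slot contributes the same term to the derivative. -/
theorem pderiv_toPoly_succ (n : ℕ) {φ : Amb (XX s l) (n + 2)}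
    (hφ : φ ∈ symmProlongation g0 (n + 1)) (i : Coord s l) :
    MvPolynomial.pderiv i (toPoly s l (n + 1) φ) =
      ((n : ℝ) + 2) • toPoly s l n (Amb.onX n φ (fVec i)) := by
  classical
  have h1 : MvPolynomial.pderiv i (toPoly s l (n + 1) φ) = toPoly s l n (Amb.onX n φ (fVec i)) +
      ∑ j, MvPolynomial.X j * MvPolynomial.pderiv i (toPoly s l n (Amb.onX n φ (fVec j))) := by
    rw [toPoly_succ, map_sum]
    simp only [MvPolynomial.pderiv_mul, MvPolynomial.pderiv_X, Finset.sum_add_distrib]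
    congr 1
    rw [Finset.sum_eq_single i]
    · simp
    · intro j _ hj
      simp [hj.symm]
    · simp
  have h2 : ∑ j, MvPolynomial.X j * MvPolynomial.pderiv i (toPoly s l n (Amb.onX n φ (fVec j))) =
      ((n : ℝ) + 1) • toPoly s l n (Amb.onX n φ (fVec i)) := by
    -- The induction ends at `n = 0`, where the symmetry is that of `σ(φ(x), y)` rather than of
    -- iterated evaluation.
    match n with
    | 0 =>
      refine (sum_X_mul_pderiv_linearPoly (Amb.onX 0 φ)
        (fun i j => bracket_comm_of_mem hφ (fVec i) (fVec j)) i).trans ?_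
      exact (one_smul ℝ _).symm.trans (congrArg (fun c : ℝ => c • _) (by simp))
    | m + 1 =>
      rw [toPoly_succ, Finset.smul_sum]
      refine Finset.sum_congr rfl fun j _ => ?_
      rw [pderiv_toPoly_succ m ((mem_symmProlongation_succ.mp hφ).2.2.2.2 _) i,
        onX_comm_of_mem hφ (fVec j), mul_smul_comm]
      congr 1
      push_cast
      ring
  rw [h1, h2]
  module

theorem eq_zero_of_toPoly_eq_zero (n : ℕ) {φ : Amb (XX s l) (n + 1)}
    (hφ : φ ∈ symmProlongation g0 n) (h : toPoly s l n φ = 0) : φ = 0 := by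
  induction n with
  | zero => exact eq_zero_of_linearPoly_eq_zero hφ h
  | succ n ih =>
    have hi : ∀ i : Coord s l, Amb.onX n φ (fVec i) = 0 := fun i => by
      refine ih ((mem_symmProlongation_succ.mp hφ).2.2.2.2 _) ?_
      have e := pderiv_toPoly_succ n hφ i
      rw [h, map_zero] at e
      exact (smul_eq_zero.mp e.symm).resolve_left (by positivity)
    refine eq_zero_of_mem_of_onX hφ fun f => ?_
    rw [← sum_fVec, map_sum]
    exact Finset.sum_eq_zero fun i _ => by rw [map_smul, hi, smul_zero]

theorem eval_toPoly (n : ℕ) {φ : Amb (XX s l) (n + 1)} (hφ : φ ∈ symmProlongation g0 n)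
    (v : XX s l) :
    MvPolynomial.eval v.2 (toPoly s l n φ) = sigmaX s l v (iterBracket n φ v) := by
  induction n with
  | zero => exact eval_linearPoly hφ v
  | succ n ih =>
    have h := ih ((mem_symmProlongation_succ.mp hφ).2.2.2.2 v)
    rw [iterBracket, ← h, onX_snd_of_mem hφ, ← sum_fVec, toPoly_succ]
    simp only [map_sum, map_mul, MvPolynomial.eval_X, map_smul, MvPolynomial.smul_eval]

end

/-! ### Integrating partial derivatives, and vanishing on sums of null vectors. -/

section

variable {s l : ℤ} {g0 : Submodule ℝ (Module.End ℝ (XX s l))}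

theorem bracket_snd_of_mem {n : ℕ} {φ : Amb (XX s l) (n + 1)} (hφ : φ ∈ symmProlongation g0 n)
    (w : XX s l) : Amb.bracket (sigmaX s l) n φ w = Amb.bracket (sigmaX s l) n φ (0, w.2) := by
  match n with
  | 0 =>
    have h : ∀ x : XX s l, x.2 = 0 → sigmaX s l x w = sigmaX s l x (0, w.2) := fun x hx => by
      rw [sigmaX_apply, sigmaX_apply, hx]
      simp
    exact h φ hφ
  | n + 1 => exact onX_snd_of_mem hφ w

theorem sigmaX_comm_of_linearPoly {p : MvPolynomial (Coord s l) ℝ} {x : Coord s l → XX s l}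
    (hx : ∀ i, linearPoly s l (x i) = MvPolynomial.pderiv i p) (i j : Coord s l) :
    sigmaX s l (x i) (fVec j) = sigmaX s l (x j) (fVec i) := by
  have h := pderiv_comm j i p
  rw [← hx, ← hx, pderiv_linearPoly, pderiv_linearPoly] at h
  rw [sigmaX_swap, MvPolynomial.C_injective _ _ h, ← sigmaX_swap]

/-- Equality of mixed partial derivatives of `p`, transported back through the injectivity of
`toPoly`. -/
theorem bracket_comm_of_toPoly {n : ℕ} {p : MvPolynomial (Coord s l) ℝ}
    {φ : Coord s l → Amb (XX s l) (n + 1)} (hφ : ∀ i, φ i ∈ symmProlongation g0 n)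
    (hp : ∀ i, toPoly s l n (φ i) = MvPolynomial.pderiv i p) (i j : Coord s l) :
    Amb.bracket (sigmaX s l) n (φ i) (fVec j) = Amb.bracket (sigmaX s l) n (φ j) (fVec i) := by
  match n with
  | 0 => exact sigmaX_comm_of_linearPoly hp i j
  | n + 1 =>
    have h := pderiv_comm j i p
    rw [← hp, ← hp, pderiv_toPoly_succ n (hφ i), pderiv_toPoly_succ n (hφ j)] at h
    have h' := smul_right_injective _ (show (n : ℝ) + 2 ≠ 0 by positivity) h
    change Amb.onX n (φ i) (fVec j) = Amb.onX n (φ j) (fVec i)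
    rw [← sub_eq_zero] at h' ⊢
    rw [← map_sub] at h'
    exact eq_zero_of_toPoly_eq_zero n (Submodule.sub_mem _
      ((mem_symmProlongation_succ.mp (hφ i)).2.2.2.2 _)
      ((mem_symmProlongation_succ.mp (hφ j)).2.2.2.2 _)) h'

/-- Euler's identity forces `ψ(f_i) = φ_i / (n + 2)` and `ψ(e) = 0`; the derivation identity for
this `ψ` is the commutation of the partial derivatives of `p`. Membership in `g0` is left to the
caller. -/
theorem exists_lift {n : ℕ} {p : MvPolynomial (Coord s l) ℝ} (hhom : p.IsHomogeneous (n + 2))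
    {φ : Coord s l → Amb (XX s l) (n + 1)} (hφ : ∀ i, φ i ∈ symmProlongation g0 n)
    (hp : ∀ i, toPoly s l n (φ i) = MvPolynomial.pderiv i p) :
    ∃ ψ : Amb (XX s l) (n + 2), Amb.onZ n ψ = 0 ∧ IsDerXX (sigmaX s l) n ψ ∧
      (∀ e, Amb.onX n ψ (e, 0) = 0) ∧ (∀ v, Amb.onX n ψ v ∈ symmProlongation g0 n) ∧
        toPoly s l (n + 1) ψ = p := by
  classical
  set A : XX s l →ₗ[ℝ] Amb (XX s l) (n + 1) := ∑ i : Coord s l,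
    (LinearMap.proj i ∘ₗ LinearMap.snd ℝ (E s l) (F s l)).smulRight (((n : ℝ) + 2)⁻¹ • φ i) with hA
  have hAv : ∀ v, A v = ∑ i : Coord s l, v.2 i • ((n : ℝ) + 2)⁻¹ • φ i := fun v => by
    simp [hA, LinearMap.sum_apply]
  have hAf : ∀ i, A (fVec i) = ((n : ℝ) + 2)⁻¹ • φ i := fun i => by
    rw [hAv, Finset.sum_eq_single i]
    · simp [fVec, Row.vec]
    · intro j _ hj
      have : (j : ℤ) ≠ i := fun h => hj (Subtype.ext h)
      simp [fVec, Row.vec, this]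
    · simp
  have hAS : ∀ v, A v ∈ symmProlongation g0 n := fun v => by
    rw [hAv]
    exact Submodule.sum_mem _ fun i _ => Submodule.smul_mem _ _ (Submodule.smul_mem _ _ (hφ i))
  have hB : ∀ v w, Amb.bracket (sigmaX s l) n (A v) w = ∑ j, ∑ i,
      (w.2 j * v.2 i * ((n : ℝ) + 2)⁻¹) • Amb.bracket (sigmaX s l) n (φ i) (fVec j) := by
    intro v w
    rw [bracket_snd_of_mem (hAS v), ← sum_fVec, map_sum]
    refine Finset.sum_congr rfl fun j _ => ?_
    rw [map_smul, hAv, map_sum, LinearMap.sum_apply, Finset.smul_sum]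
    refine Finset.sum_congr rfl fun i _ => ?_
    rw [map_smul, map_smul, LinearMap.smul_apply, LinearMap.smul_apply, smul_smul, smul_smul]
  refine ⟨Amb.ofX n A, rfl, fun v w => ?_, fun e => ?_, hAS, ?_⟩
  · rw [Amb.onZ_ofX, Amb.onX_ofX, LinearMap.zero_apply, eq_comm, sub_eq_zero, hB, hB,
      Finset.sum_comm]
    refine Finset.sum_congr rfl fun i _ => Finset.sum_congr rfl fun j _ => ?_
    rw [bracket_comm_of_toPoly hφ hp, mul_comm (w.2 j)]
  · rw [Amb.onX_ofX, hAv]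
    simp
  · have hE := hhom.sum_X_mul_pderiv
    rw [toPoly_succ]
    simp only [Amb.onX_ofX, hAf, map_smul, hp, mul_smul_comm]
    rw [← Finset.smul_sum, hE, ← Nat.cast_smul_eq_nsmul ℝ, smul_smul]
    push_cast
    rw [inv_mul_cancel₀ (by positivity), one_smul]

theorem exists_linearPoly_eq {p : MvPolynomial (Coord s l) ℝ} (hp : p.IsHomogeneous 1) :
    ∃ x : XX s l, x.2 = 0 ∧ linearPoly s l x = p := by
  have hc : ∀ i, ∃ c, MvPolynomial.pderiv i p = MvPolynomial.C c := fun i =>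
    ⟨_, MvPolynomial.totalDegree_eq_zero_iff_eq_C.mp
      ((MvPolynomial.totalDegree_zero_iff_isHomogeneous _).mpr hp.pderiv)⟩
  choose c hc using hc
  -- Solves `σ(f_i, x) = c_i`: the left side is `-(-1)^{s+i}` times the coordinate of `x` along
  -- `e_{-i}`.
  refine ⟨(fun m => -(-1) ^ (s - (m : ℤ)) * c ⟨-m, ?_⟩, 0), rfl, ?_⟩
  · have := Finset.mem_Icc.mp m.2
    exact Finset.mem_Icc.mpr ⟨by omega, by omega⟩
  · rw [linearPoly_apply]
    refine Eq.trans ?_ (hp.sum_X_mul_pderiv.trans (one_smul _ _))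
    refine Finset.sum_congr rfl fun i _ => ?_
    have hi := Finset.mem_Icc.mp i.2
    have hm : -(i : ℤ) ∈ Finset.Icc (s - l) s := Finset.mem_Icc.mpr ⟨by omega, by omega⟩
    rw [hc, mul_comm, ← MvPolynomial.smul_eq_C_mul, sigmaX_swap, sigmaX_apply]
    congr 1
    simp only [fVec, map_zero, sub_zero]
    rw [tau_vec_right hi.1 hi.2, Row.coeff_of_mem hm, sub_neg_eq_add]
    simp only [neg_neg, Subtype.coe_eta]
    rw [neg_mul, mul_neg, neg_neg, ← mul_assoc, ← mul_zpow]
    simp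

/-- The vectors of `F` on which all forms defined by elements of `g0` vanish. -/
def nullVectors (g0 : Submodule ℝ (Module.End ℝ (XX s l))) : Set (F s l) :=
  {x | ∀ A ∈ g0, formF A x x = 0}

theorem onX_mem_of_mem {φ : Amb (XX s l) 2} (hφ : φ ∈ symmProlongation g0 1) :
    Amb.onX 0 φ ∈ g0 := (mem_symmProlongation_succ.mp hφ).1

theorem sigmaX_eq_formF (A : Module.End ℝ (XX s l)) (x y : F s l) :
    sigmaX s l (A (0, x)) (0, y) = formF A x y := by
  simp [sigmaX_apply, formF_apply]

theorem formF_comm_of_mem {φ : Amb (XX s l) 2} (hφ : φ ∈ symmProlongation g0 1) (x y : F s l) :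
    formF (Amb.onX 0 φ) x y = formF (Amb.onX 0 φ) y x := by
  have h : sigmaX s l (Amb.onX 0 φ (0, x)) (0, y) = sigmaX s l (Amb.onX 0 φ (0, y)) (0, x) :=
    bracket_comm_of_mem hφ (0, x) (0, y)
  exact (sigmaX_eq_formF _ x y).symm.trans (h.trans (sigmaX_eq_formF _ y x))

/-- Inserting one more vector `f` and using symmetry turns `φ(x)(x)` into `φ(f)(x)(x)`, eventually
the value at `(x, x)` of a form from `g0`. -/
theorem onX_onX_eq_zero {n : ℕ} {φ : Amb (XX s l) (n + 3)} (hφ : φ ∈ symmProlongation g0 (n + 2))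
    {x : F s l} (hx : x ∈ nullVectors g0) :
    Amb.onX n (Amb.onX (n + 1) φ (0, x)) (0, x) = 0 := by
  have hS := fun v => (mem_symmProlongation_succ.mp hφ).2.2.2.2 v
  induction n with
  | zero =>
    have h2 : ∀ y : XX s l, y.2 = 0 → (∀ f, tau s l y.1 f = 0) → y = 0 := fun y hy h =>
      Prod.ext (eq_zero_of_tau_right h) hy
    refine h2 _ ((mem_symmProlongation_succ.mp (hS (0, x))).2.2.2.2 (0, x)) fun f => ?_
    change formF (Amb.onX 0 (Amb.onX 1 φ (0, x))) x f = 0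
    rw [formF_comm_of_mem (hS (0, x))]
    have h := onX_comm_of_mem hφ (0, x) (0, f)
    have h3 : formF (Amb.onX 0 (Amb.onX 1 φ (0, x))) f x =
        formF (Amb.onX 0 (Amb.onX 1 φ (0, f))) x x :=
      congrArg (fun y : XX s l => tau s l y.1 x) h
    rw [h3]
    exact hx _ (onX_mem_of_mem (hS (0, f)))
  | succ n ih =>
    refine eq_zero_of_mem_of_onX ((mem_symmProlongation_succ.mp (hS (0, x))).2.2.2.2 (0, x))
      fun f => ?_
    rw [onX_comm_of_mem (hS (0, x)), onX_comm_of_mem hφ (0, x)]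
    exact ih (hS (0, f)) fun v => (mem_symmProlongation_succ.mp (hS (0, f))).2.2.2.2 v

theorem hasDerivAt_toPoly {n : ℕ} {φ : Amb (XX s l) (n + 2)}
    (hφ : φ ∈ symmProlongation g0 (n + 1)) (y x : F s l) (t : ℝ) :
    HasDerivAt (fun t : ℝ => MvPolynomial.eval (y + t • x) (toPoly s l (n + 1) φ))
      (((n : ℝ) + 2) * MvPolynomial.eval (y + t • x) (toPoly s l n (Amb.onX n φ (0, x)))) t := by
  refine (hasDerivAt_eval_add_smul _ y x t).congr_deriv ?_
  rw [← sum_fVec x, map_sum, map_sum, map_sum, Finset.mul_sum]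
  refine Finset.sum_congr rfl fun i _ => ?_
  rw [pderiv_toPoly_succ n hφ, MvPolynomial.smul_eval, map_smul (Amb.onX n φ),
    map_smul (toPoly s l n), MvPolynomial.smul_eval]
  ring

/-- The second derivative in a null direction is a multiple of the polynomial of `φ(x)(x) = 0`, so
the polynomial is affine in that direction. -/
theorem eval_add_toPoly {n : ℕ} {φ : Amb (XX s l) (n + 3)} (hφ : φ ∈ symmProlongation g0 (n + 2))
    {x : F s l} (hx : x ∈ nullVectors g0) (y : F s l) :
    MvPolynomial.eval (y + x) (toPoly s l (n + 2) φ) = MvPolynomial.eval y (toPoly s l (n + 2) φ) +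
      ((n : ℝ) + 3) * MvPolynomial.eval y (toPoly s l (n + 1) (Amb.onX (n + 1) φ (0, x))) := by
  set g : ℝ → ℝ := fun t =>
    MvPolynomial.eval (y + t • x) (toPoly s l (n + 1) (Amb.onX (n + 1) φ (0, x))) with hg
  have hg' : ∀ t, HasDerivAt g 0 t := fun t => by
    refine (hasDerivAt_toPoly ((mem_symmProlongation_succ.mp hφ).2.2.2.2 (0, x)) y x t).congr_deriv ?_
    rw [onX_onX_eq_zero hφ hx, map_zero, map_zero, mul_zero]
  have hgc : ∀ t, g t = g 0 := fun t =>
    is_const_of_deriv_eq_zero (fun t => (hg' t).differentiableAt) (fun t => (hg' t).deriv) t 0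
  set h : ℝ → ℝ := fun t =>
    MvPolynomial.eval (y + t • x) (toPoly s l (n + 2) φ) - t * (((n : ℝ) + 3) * g 0) with hh
  have hh' : ∀ t, HasDerivAt h 0 t := fun t => by
    refine ((hasDerivAt_toPoly hφ y x t).sub
      ((hasDerivAt_id t).mul_const (((n : ℝ) + 3) * g 0))).congr_deriv ?_
    have := hgc t
    simp only [hg] at this ⊢
    rw [this]
    push_cast
    ring
  have := is_const_of_deriv_eq_zero (fun t => (hh' t).differentiableAt) (fun t => (hh' t).deriv) 1 0
  simp only [hh, hg, one_smul, zero_smul, add_zero, one_mul, zero_mul, sub_zero] at this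
  linarith

theorem eval_toPoly_one {φ : Amb (XX s l) 2} (hφ : φ ∈ symmProlongation g0 1) (x : F s l) :
    MvPolynomial.eval x (toPoly s l 1 φ) = -formF (Amb.onX 0 φ) x x := by
  refine (eval_toPoly 1 hφ (0, x)).trans ?_
  exact (sigmaX_swap _ _).trans (congrArg Neg.neg (sigmaX_eq_formF _ x x))

/-- Splitting off one null vector leaves `m` vectors, once with `φ` and once with `φ(x 0)` of degree
one lower; the bound `m ≤ k + 1` survives in both terms. -/
theorem eval_sum_toPoly {k m : ℕ} (hm : m ≤ k + 1) {φ : Amb (XX s l) (k + 2)}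
    (hφ : φ ∈ symmProlongation g0 (k + 1)) {x : Fin m → F s l} (hx : ∀ i, x i ∈ nullVectors g0) :
    MvPolynomial.eval (∑ i, x i) (toPoly s l (k + 1) φ) = 0 := by
  induction m generalizing k with
  | zero =>
    rw [Fin.sum_univ_zero]
    exact eval_zero_of_isHomogeneous (isHomogeneous_toPoly _ φ)
  | succ m ih =>
    match k with
    | 0 =>
      obtain rfl : m = 0 := by omega
      rw [Fin.sum_univ_one]
      exact (eval_toPoly_one hφ (x 0)).trans
        (by rw [hx 0 _ (onX_mem_of_mem hφ), neg_zero])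
    | k + 1 =>
      rw [Fin.sum_univ_succ, add_comm, eval_add_toPoly hφ (hx 0)]
      by_cases hmk : m ≤ k + 1
      · rw [ih (by omega) hφ fun i => hx _,
          ih hmk ((mem_symmProlongation_succ.mp hφ).2.2.2.2 _) fun i => hx _, mul_zero, add_zero]
      · omega

end

section

/-! ### Forms vanishing on secant varieties -/

section Cone

open scoped LinearAlgebra.Projectivization

variable {ι : Type}

/-- The affine cone over a subset of a projective space. -/
def cone (V : Set (ℙ ℝ (ι → ℝ))) : Set (ι → ℝ) :=
  {v | ∀ hv : v ≠ 0, Projectivization.mk ℝ v hv ∈ V}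

theorem subset_zariskiClosure (V : Set (ℙ ℝ (ι → ℝ))) : V ⊆ zariskiClosure V := fun p hp _ P hP =>
  hP.2 p.rep p.rep_nonzero (by rwa [Projectivization.mk_rep])

theorem vanishingForms_zariskiClosure [Fintype ι] (d : ℕ) (V : Set (ℙ ℝ (ι → ℝ))) :
    vanishingForms d (zariskiClosure V) = vanishingForms d V := by
  ext P
  constructor
  · exact fun hP => ⟨hP.1, fun v hv h => hP.2 v hv (subset_zariskiClosure V h)⟩
  · refine fun hP => ⟨hP.1, fun v hv h => ?_⟩
    have h0 := h d P hP
    obtain ⟨a, ha⟩ := Projectivization.exists_smul_eq_mk_rep ℝ v hv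
    rw [← ha, Units.smul_def, eval_smul_of_isHomogeneous hP.1] at h0
    exact (mul_eq_zero.mp h0).resolve_left (pow_ne_zero _ a.ne_zero)

theorem mk_mem_projSubspace {W : Submodule ℝ (ι → ℝ)} {v : ι → ℝ} (hv : v ≠ 0) :
    Projectivization.mk ℝ v hv ∈ projSubspace W ↔ v ∈ W := by
  rw [projSubspace, Set.mem_ofPred, Projectivization.submodule_mk,
    Submodule.span_singleton_le_iff_mem]

theorem mem_cone_of_mem_submodule {V : Set (ℙ ℝ (ι → ℝ))} {p : ℙ ℝ (ι → ℝ)} (hp : p ∈ V)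
    {v : ι → ℝ} (hv : v ∈ p.submodule) : v ∈ cone V := by
  intro hv0
  rw [Projectivization.submodule_eq, Submodule.mem_span_singleton] at hv
  obtain ⟨a, rfl⟩ := hv
  rwa [(Projectivization.mk_eq_mk_iff' ℝ _ _ hv0 p.rep_nonzero).mpr ⟨a, rfl⟩,
    Projectivization.mk_rep]

/-- Passing to the Zariski closure does not change the forms, and a vector in the span of `k + 1`
points is a sum of `k + 1` cone vectors. Nonemptiness supplies a point for zero summands. -/
theorem mem_vanishingForms_secantVariety [Fintype ι] {k d : ℕ} {V : Set (ℙ ℝ (ι → ℝ))} (hV : V.Nonempty)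
    {P : MvPolynomial ι ℝ} :
    P ∈ vanishingForms (d + 1) (secantVariety k V) ↔ P.IsHomogeneous (d + 1) ∧
      ∀ x : Fin (k + 1) → ι → ℝ, (∀ i, x i ∈ cone V) → MvPolynomial.eval (∑ i, x i) P = 0 := by
  classical
  rw [secantVariety, vanishingForms_zariskiClosure]
  constructor
  · refine fun hP => ⟨hP.1, fun x hx => ?_⟩
    by_cases hv : ∑ i, x i = 0
    · rw [hv, eval_zero_of_isHomogeneous hP.1]
    obtain ⟨p₀, hp₀⟩ := hV
    have : ∀ i, ∃ p ∈ V, x i ∈ p.submodule := fun i => by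
      by_cases hi : x i = 0
      · exact ⟨p₀, hp₀, hi ▸ Submodule.zero_mem _⟩
      · exact ⟨_, hx i hi, by
          rw [Projectivization.submodule_mk]
          exact Submodule.mem_span_singleton_self _⟩
    choose p hpV hp using this
    refine hP.2 _ hv (Set.mem_iUnion.mpr ⟨⟨p, hpV⟩, (mk_mem_projSubspace hv).mpr ?_⟩)
    exact Submodule.sum_mem _ fun i _ =>
      Submodule.mem_iSup_of_mem (p := fun i => (p i).submodule) i (hp i)
  · refine fun hP => ⟨hP.1, fun v hv hmem => ?_⟩
    obtain ⟨⟨p, hpV⟩, hp⟩ := Set.mem_iUnion.mp hmem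
    rw [mk_mem_projSubspace, Submodule.mem_iSup_iff_exists_finsupp] at hp
    obtain ⟨f, hf, rfl⟩ := hp
    rw [Finsupp.sum_fintype _ _ fun _ => rfl]
    exact hP.2 _ fun i => mem_cone_of_mem_submodule (hpV i) (hf i)

end Cone

variable {s l : ℤ}

/-- The tangential developable of the rational normal curve. -/
abbrev developable (s l : ℤ) : Set (Projectivization ℝ (F s l)) :=
  tangentialDevelopable (l - s - 1).toNat (normalCurve s l)

theorem expShift_mem_cone (hsl : s < l) (t : ℝ) {x : F s l} (hx : x ∈ Row.pos (-s) (l - s)) :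
    Row.expShift (-s) (l - s) t x ∈ cone (developable s l) := by
  refine fun hv => subset_zariskiClosure _ (Set.mem_iUnion.mpr ⟨t, (mk_mem_projSubspace hv).mpr ?_⟩)
  rw [osculatingSubspace_normalCurve hsl]
  exact Submodule.mem_map_of_mem hx

theorem developable_nonempty (hsl : s < l) (hls : l < 2 * s) : (developable s l).Nonempty := by
  have h : Row.vec (-s) (l - s) (l - s) ≠ 0 := fun h => by
    have := Row.coeff_vec_self (a := -s) (b := l - s) (i := l - s) (by omega) le_rfl
    rw [h, map_zero] at this
    exact zero_ne_one this
  have := expShift_mem_cone (s := s) hsl 0 (Row.vec_mem_pos (i := l - s) (by omega) le_rfl)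
  rw [Row.expShift_zero] at this
  exact ⟨_, this h⟩

/-- The form of `A` on the diagonal is a quadric vanishing on the osculating subspaces, hence on
their Zariski closure. -/
theorem cone_developable_subset_nullVectors (hsl : s < l) :
    cone (developable s l) ⊆ nullVectors (uF (sigmaX s l) (gradingX s l) (deltaX s l)) := by
  intro v hv A hA
  by_cases hv0 : v = 0
  · rw [hv0, map_zero]
  set P : MvPolynomial (Coord s l) ℝ := ∑ i : Coord s l, ∑ j : Coord s l,
    MvPolynomial.C (formF A (Row.vec _ _ j) (Row.vec _ _ i)) *
      (MvPolynomial.X i * MvPolynomial.X j) with hP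
  have heval : ∀ w, MvPolynomial.eval w P = formF A w w := fun w => by
    conv_rhs => rw [← Row.sum_vec w]
    simp only [hP, map_sum, map_mul, MvPolynomial.eval_C, MvPolynomial.eval_X,
      LinearMap.sum_apply, map_smul, LinearMap.smul_apply, smul_eq_mul]
    exact Finset.sum_congr rfl fun i _ => by
      rw [Finset.mul_sum]
      exact Finset.sum_congr rfl fun j _ => by ring
  have hPv : P ∈ vanishingForms 2 (developable s l) := by
    rw [developable, tangentialDevelopable, vanishingForms_zariskiClosure]
    refine ⟨?_, fun w hw hmem => ?_⟩
    · exact MvPolynomial.IsHomogeneous.sum _ _ _ fun i _ =>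
        MvPolynomial.IsHomogeneous.sum _ _ _ fun j _ =>
          ((MvPolynomial.isHomogeneous_X ℝ i).mul (MvPolynomial.isHomogeneous_X ℝ j)).C_mul _
    · obtain ⟨t, ht⟩ := Set.mem_iUnion.mp hmem
      rw [mk_mem_projSubspace, osculatingSubspace_normalCurve hsl] at ht
      obtain ⟨x, hx, rfl⟩ := ht
      rw [heval]
      exact formF_expShift_eq_zero_of_mem_uF hA t hx hx
  rw [← heval]
  exact hPv.2 v hv0 (hv hv0)

/-- If `y` is a sum of `k + 1` cone vectors and `w` is on the curve, then `p(y + c w) = 0` for all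
`c`, so the differential of `p` at `y` kills `w`. The curve spans `F`, so the differential is zero.
-/
theorem pderiv_mem_vanishingForms (hsl : s < l) (hls : l < 2 * s) {k : ℕ}
    {p : MvPolynomial (Coord s l) ℝ}
    (hp : p ∈ vanishingForms (k + 3) (secantVariety (k + 1) (developable s l))) (i : Coord s l) :
    MvPolynomial.pderiv i p ∈ vanishingForms (k + 2) (secantVariety k (developable s l)) := by
  classical
  have hne := developable_nonempty hsl hls
  obtain ⟨hhom, hp⟩ := (mem_vanishingForms_secantVariety hne).mp hp
  refine (mem_vanishingForms_secantVariety hne).mpr ⟨hhom.pderiv, fun x hx => ?_⟩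
  set f : F s l →ₗ[ℝ] ℝ :=
    ∑ i, MvPolynomial.eval (∑ j, x j) (MvPolynomial.pderiv i p) • LinearMap.proj i with hf
  have hf0 : f = 0 := by
    refine Row.functional_eq_zero_of_expShift f fun t => ?_
    set w := Row.expShift (-s) (l - s) t (Row.vec (-s) (l - s) (l - s)) with hw
    have hd := hasDerivAt_eval_add_smul p (∑ j, x j) w 0
    have h0 : (fun c : ℝ => MvPolynomial.eval (∑ j, x j + c • w) p) = fun _ => 0 := by
      funext c
      have hcw : c • w ∈ cone (developable s l) := by
        rw [hw, ← map_smul]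
        exact expShift_mem_cone hsl t (Submodule.smul_mem _ _ (Row.vec_mem_pos (by omega) le_rfl))
      have := hp (Fin.cons (c • w) x) (Fin.cases hcw hx)
      rwa [Fin.sum_univ_succ, Fin.cons_zero, add_comm] at this
    rw [h0] at hd
    have := hd.unique (hasDerivAt_const 0 0)
    rw [zero_smul, add_zero] at this
    rw [← this, hf, LinearMap.sum_apply]
    exact Finset.sum_congr rfl fun j _ => mul_comm _ _
  have := LinearMap.congr_fun hf0 (Pi.single i 1)
  simpa [hf, LinearMap.sum_apply, Pi.single_apply] using this

theorem exists_toPoly_eq (hsl : s < l) (hls : l < 2 * s) (k : ℕ) {p : MvPolynomial (Coord s l) ℝ}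
    (hp : p ∈ vanishingForms (k + 2) (secantVariety k (developable s l))) :
    ∃ φ ∈ symmProlongation (uF (sigmaX s l) (gradingX s l) (deltaX s l)) (k + 1),
      toPoly s l (k + 1) φ = p := by
  have hne := developable_nonempty hsl hls
  induction k generalizing p with
  | zero =>
    obtain ⟨hhom, hv⟩ := (mem_vanishingForms_secantVariety hne).mp hp
    choose x hx hxp using fun i => exists_linearPoly_eq (hhom.pderiv (i := i))
    -- The quadric is first realised with no condition in degree zero; membership in `𝔲ᶠ` then
    -- follows from its vanishing on the osculating subspaces.
    obtain ⟨ψ, hZ, hD, hE, hS, hψ⟩ := exists_lift (n := 0) (g0 := ⊤) hhom (φ := x) hx hxp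
    have hψS : ψ ∈ symmProlongation ⊤ 1 :=
      mem_symmProlongation_succ.mpr ⟨trivial, hZ, hD, hE, hS⟩
    refine ⟨ψ, mem_symmProlongation_succ.mpr ⟨?_, hZ, hD, hE, hS⟩, hψ⟩
    have hsymm := formF_comm_of_mem hψS
    refine mem_uF_of_formF_expShift hsl hls ⟨hE, fun f => hS (0, f), hsymm⟩ fun t x hx y hy => ?_
    have hq : ∀ z ∈ Row.pos (-s) (l - s), formF (Amb.onX 0 ψ) (Row.expShift (-s) (l - s) t z)
        (Row.expShift (-s) (l - s) t z) = 0 := fun z hz => by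
      have h1 := eval_toPoly_one hψS (Row.expShift (-s) (l - s) t z)
      have h2 := hv (fun _ => Row.expShift (-s) (l - s) t z) fun _ => expShift_mem_cone hsl t hz
      rw [Fin.sum_univ_one, ← hψ, h1] at h2
      exact neg_eq_zero.mp h2
    -- Polarisation, possible because the osculating subspace is linear.
    have h1 := hq _ (Submodule.add_mem _ hx hy)
    simp only [map_add, LinearMap.add_apply] at h1
    rw [hq x hx, hq y hy, hsymm (Row.expShift (-s) (l - s) t y)] at h1
    linarith
  | succ k ih =>
    choose φ hφ hφp using fun i => ih (pderiv_mem_vanishingForms hsl hls hp i)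
    obtain ⟨ψ, hZ, hD, hE, hS, hψ⟩ := exists_lift hp.1 hφ hφp
    exact ⟨ψ, mem_symmProlongation_succ.mpr ⟨trivial, hZ, hD, hE, hS⟩, hψ⟩

theorem toPoly_mem_vanishingForms (hsl : s < l) (hls : l < 2 * s) (k : ℕ)
    {φ : Amb (XX s l) (k + 2)}
    (hφ : φ ∈ symmProlongation (uF (sigmaX s l) (gradingX s l) (deltaX s l)) (k + 1)) :
    toPoly s l (k + 1) φ ∈ vanishingForms (k + 2) (secantVariety k (developable s l)) :=
  (mem_vanishingForms_secantVariety (developable_nonempty hsl hls)).mpr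
    ⟨isHomogeneous_toPoly _ φ, fun _ hx => eval_sum_toPoly le_rfl hφ fun i =>
      cone_developable_subset_nullVectors hsl (hx i)⟩

end

end

end FlagProlongation

theorem mainTheorem7 (s l : ℤ) (hsl : s < l) (hls : l < 2 * s) (k : ℕ) (hk : 1 ≤ k) :
    ∃ Φ : FlagProlongation.tanakaProlongation (FlagProlongation.sigmaX s l)
          (FlagProlongation.uF (FlagProlongation.sigmaX s l) (FlagProlongation.gradingX s l)
            (FlagProlongation.deltaX s l)) k
        ≃ₗ[ℝ] FlagProlongation.vanishingForms (k + 2)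
          (FlagProlongation.secantVariety k
            (FlagProlongation.tangentialDevelopable (l - s - 1).toNat
              (FlagProlongation.normalCurve s l))),
      ∀ (φ : FlagProlongation.tanakaProlongation (FlagProlongation.sigmaX s l)
          (FlagProlongation.uF (FlagProlongation.sigmaX s l) (FlagProlongation.gradingX s l)
            (FlagProlongation.deltaX s l)) k)
        (v : FlagProlongation.XX s l),
        MvPolynomial.eval v.2 (Φ φ : MvPolynomial _ ℝ) =
          FlagProlongation.sigmaX s l v
            (FlagProlongation.iterBracket (k + 1) (φ : FlagProlongation.Amb _ (k + 2)) v) := by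
  -- The identification with the symmetric prolongation starts in degree 1: in degree 0 the Tanaka
  -- prolongation is all of `𝔲ᶠ`, including its diagonal blocks.
  obtain ⟨k, rfl⟩ : ∃ m, k = m + 1 := ⟨k - 1, by omega⟩
  have hmem := SetLike.ext_iff.mp (FlagProlongation.tanakaAux_eq_symmProlongation hsl hls k)
  refine ⟨LinearEquiv.ofBijective ((FlagProlongation.toPoly s l (k + 2)).restrict fun φ hφ =>
    FlagProlongation.toPoly_mem_vanishingForms hsl hls (k + 1) ((hmem φ).mp hφ)) ⟨?_, ?_⟩, ?_⟩
  · refine (injective_iff_map_eq_zero _).mpr fun φ hφ => Subtype.ext ?_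
    exact FlagProlongation.eq_zero_of_toPoly_eq_zero (k + 2) ((hmem _).mp φ.2)
      (congrArg Subtype.val hφ)
  · rintro ⟨p, hp⟩
    obtain ⟨φ, hφ, rfl⟩ := FlagProlongation.exists_toPoly_eq hsl hls (k + 1) hp
    exact ⟨⟨φ, (hmem φ).mpr hφ⟩, rfl⟩
  · exact fun φ v => FlagProlongation.eval_toPoly (k + 2) ((hmem _).mp φ.2) v
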